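/- **Setting.** Let $\Omega\subset\mathbb R^3$ be open and bounded, with coordinates $(x,y,z)$. The medium is piecewise continuous: $\Omega$ is covered, up to closure, by finitely many disjoint open subdomains, and on the closure of each of them the bulk modulus $\kappa>0$ and the density $\rho>0$ are continuous. The damping functions $d_\eta=d_\eta(\eta)$, $\eta=x,y,z$, are continuously differentiable and satisfy $d_\eta\ge 0$ on $\overline\Omega$, and $$\beta=\max_{\eta=x,y,z;\ \Omega}\sqrt{\kappa/\rho}\,\left|\frac{d_\eta'(\eta)}{d_\eta(\eta)}\right|$$ is assumed finite (with $0/0=0$, and $c/0=\infty$ for $c\neq 0$). For $s\in\mathbb C$ put $S_\eta=1+d_\eta/s$, $\mathbf S=\mathrm{diag}(S_yS_z,\,S_xS_z,\,S_xS_y)$ and $\nabla_d=(S_x^{-1}\partial_x,\,S_y^{-1}\partial_y,\,S_z^{-1}\partial_z)^T$. **Discretization.** Let $p\ge 1$. Consider conforming meshes of $\overline\Omega$ (no hanging nodes) whose elements $K$ are affine images of finitely many fixed reference Lagrange elements of order $p$ (for example $P_p$ on tetrahedra or $Q_p$ on bricks). Here a reference Lagrange element of order $p$ is a convex polytope with a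 complex polynomial space that contains all polynomials of total degree at most $p$ and is stable under partial derivatives, and with a unisolvent set of nodes in the polytope. Conformity means: two elements meet in a common face; the nodes of one element lying in another one are nodes of the latter; on a common face two local functions that agree at the nodes in that face agree; a local function vanishing at the nodes of its element on $\partial\Omega$ vanishes on the part of $\partial\Omega$ in that element. Let $h$ be the largest element diameter, and let the meshes be shape regular with parameter $\sigma>0$: each $K$ contains a ball of radius $\operatorname{diam}(K)/\sigma$. Let $N_p(K)$ be the local polynomial space on $K$, and let $V_h$ be the space of complex continuous functions $v$ on $\overline\Omega$ with $v|_K\in N_p(K)$ for all $K$ and $v=0$ on $\partial\Omega$. Let $(f,g)_h$ denote the quadrature of $f^*g$, by a fixed rule with positive weights and with points in the element on each reference element, transported to the elements $K$; put $\|f\|_{b,h}^2=(bf,f)_h$. Derivatives of piecewise polynomials are taken elementwise; at a quadrature point on a material interface the value of $(\kappa,\rho)$ used is the one-sided value from any one of the adjacent subdomains. Assume the Interpolation Condition: on each element, arbitrary values at the quadrature points are interpolated by a unique polynomial of the local polynomial space. **Theorem.** There is a constant $C$, which does not depend on the mesh, on $s$, on the data or on the solution (but may depend on $\Omega$, $\kappa$,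 $\rho$, $d_\eta$, the reference elements with their quadratures, and $\sigma$), such that for every such mesh there is a number $\beta_h$, independent of $s$, of the data and of the solution, with $$|\beta_h-\beta|\le C\,h^{p-1}$$ and with the following property. Let $s\in\mathbb C$ with $\operatorname{Re}(s)=a>\beta_h$, let $\hat F_u$ be given by arbitrary complex values at the quadrature points of each element, and let $\hat u_h\in V_h$ solve the reduced discrete weak form in Laplace space (with homogeneous initial data) $$\left(\frac{s^2S_xS_yS_z}{\kappa}\hat u_h,v\right)_h=-\left(\frac1\rho\mathbf S\nabla_d\hat u_h,\nabla v\right)_h+\left(\frac1\kappa\hat F_u,v\right)_h\qquad\text{for all }v\in V_h .$$ Then $$(a-\beta_h)\,E_{\hat u_h}^2(s)\le 2\,E_{\hat u_h}(s)\,E_{f_h}(s),$$ where $E_{\hat u_h}(s),E_{f_h}(s)\ge 0$ are defined by $$E_{\hat u_h}^2(s)=\|s\hat u_h\|_{1/\kappa,h}^2+\sum_{\eta=x,y,z}\left\|\frac1{S_\eta}\frac{\partial\hat u_h}{\partial\eta}\right\|_{1/\rho,h}^2,\qquad E_{f_h}^2(s)=\|\hat F_u\|_{1/\kappa,h}^2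 .$$ -/

import Mathlib

open scoped ENNReal ComplexConjugate
open MvPolynomial

noncomputable section

namespace PML

/-- Euclidean three-space, with coordinates `x 0, x 1, x 2` for `x, y, z`. -/
abbrev E3 := EuclideanSpace ℝ (Fin 3)

/-! ### The medium and the damping -/

/-- A piecewise continuous heterogeneous medium in `Ω`: finitely many disjoint open subdomains whose
closures cover the closure of `Ω`, and on the closure of each of them a continuous positive
bulk modulus `kappa j` and density `rho j`. At a point of a material interface the medium has one
(one-sided) value for each subdomain that touches the point. -/
structure Medium (Ω : Set E3) where
  J : Type
  [finite : Finite J]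
  sub : J → Set E3
  isOpen_sub : ∀ j, IsOpen (sub j)
  disjoint_sub : ∀ j k, j ≠ k → Disjoint (sub j) (sub k)
  cover : ⋃ j, closure (sub j) = closure Ω
  kappa : J → E3 → ℝ
  rho : J → E3 → ℝ
  kappa_cont : ∀ j, ContinuousOn (kappa j) (closure (sub j))
  rho_cont : ∀ j, ContinuousOn (rho j) (closure (sub j))
  kappa_pos : ∀ j, ∀ x ∈ closure (sub j), 0 < kappa j x
  rho_pos : ∀ j, ∀ x ∈ closure (sub j), 0 < rho j x

/-- `β = max_{η, Ω} √(κ/ρ) |d_η' / d_η|`, as an extended nonnegative number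
(in `ℝ≥0∞` one has `0 / 0 = 0`, and `c / 0 = ∞` for `c ≠ 0`). -/
def dampingRate {Ω : Set E3} (M : Medium Ω) (d : Fin 3 → ℝ → ℝ) : ℝ≥0∞ :=
  ⨆ (η : Fin 3) (j : M.J) (x : E3) (_ : x ∈ closure (M.sub j)),
    ENNReal.ofReal (√(M.kappa j x / M.rho j x) * |deriv (d η) (x η)|) /
      ENNReal.ofReal (d η (x η))

/-- The complex stretching factor `S_η = 1 + d_η / s`, at the point `x`. -/
def stretch (d : Fin 3 → ℝ → ℝ) (s : ℂ) (η : Fin 3) (x : E3) : ℂ :=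
  1 + (d η (x η) : ℂ) / s

/-! ### Finite elements and quadrature -/

/-- The value of a complex polynomial at a real point. -/
def evalAt (P : MvPolynomial (Fin 3) ℂ) (x : E3) : ℂ :=
  MvPolynomial.eval (fun i => ((x i : ℝ) : ℂ)) P

/-- A (reference) Lagrange finite element of polynomial order `p`: a nondegenerate convex polytope,
a space of polynomials which contains all polynomials of total degree at most `p` and is stable
under partial derivatives, and nodes in the polytope such that nodal values determine a unique
element of the space. (For example tetrahedra with polynomials of total degree at most `p`, bricks
with polynomials of degree at most `p` in each variable.) -/
structure LagrangeElement (p : ℕ) where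
  vertices : Finset E3
  interior_nonempty : (interior (convexHull ℝ (vertices : Set E3))).Nonempty
  space : Submodule ℂ (MvPolynomial (Fin 3) ℂ)
  order_le : MvPolynomial.restrictTotalDegree (Fin 3) ℂ p ≤ space
  pderiv_mem : ∀ η : Fin 3, ∀ P ∈ space, pderiv η P ∈ space
  n : ℕ
  node : Fin n → E3
  node_mem : ∀ i, node i ∈ convexHull ℝ (vertices : Set E3)
  unisolvent : ∀ c : Fin n → ℂ, ∃! P : MvPolynomial (Fin 3) ℂ,
    P ∈ space ∧ ∀ i, evalAt P (node i) = c i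

namespace LagrangeElement

variable {p : ℕ} (e : LagrangeElement p)

/-- The reference polytope. -/
def cell : Set E3 := convexHull ℝ (e.vertices : Set E3)

/-- The image of the reference polytope under an affine map. -/
def mapCell (A : E3 ≃ᵃ[ℝ] E3) : Set E3 := A '' e.cell

/-- The image of a node. -/
def mapNode (A : E3 ≃ᵃ[ℝ] E3) (i : Fin e.n) : E3 := A (e.node i)

/-- The local polynomial space of the image element: the polynomials `P` whose pull-back `P ∘ A`
is in the reference space. -/
def mapSpace (A : E3 ≃ᵃ[ℝ] E3) : Set (MvPolynomial (Fin 3) ℂ) :=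
  {P | ∃ Q ∈ e.space, ∀ x : E3, evalAt P (A x) = evalAt Q x}

end LagrangeElement

/-- A quadrature rule with positive weights on a reference element. -/
structure Quadrature {p : ℕ} (e : LagrangeElement p) where
  m : ℕ
  point : Fin m → E3
  point_mem : ∀ i, point i ∈ e.cell
  weight : Fin m → ℝ
  weight_pos : ∀ i, 0 < weight i

/-- The Interpolation Condition: arbitrary values at the quadrature points are interpolated by a
(unique) polynomial of the local polynomial space. -/
def InterpolationCondition {p : ℕ} {e : LagrangeElement p} (q : Quadrature e) : Prop :=
  ∀ c : Fin q.m → ℂ, ∃! P : MvPolynomial (Fin 3) ℂ,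
    P ∈ e.space ∧ ∀ i, evalAt P (q.point i) = c i

/-- A conforming mesh of `Ω` (no hanging nodes), whose elements are affine images of the reference
elements `el r`. -/
structure Mesh (Ω : Set E3) {p : ℕ} {R : Type} (el : R → LagrangeElement p) where
  ι : Type
  [fintype : Fintype ι]
  ref : ι → R
  map : ι → E3 ≃ᵃ[ℝ] E3
  cover : ⋃ K, (el (ref K)).mapCell (map K) = closure Ω
  disjoint_interior : ∀ K L, K ≠ L →
    Disjoint (interior ((el (ref K)).mapCell (map K))) (interior ((el (ref L)).mapCell (map L)))
  /-- two elements meet in a common face -/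
  face_to_face : ∀ K L, IsExposed ℝ ((el (ref K)).mapCell (map K))
    ((el (ref K)).mapCell (map K) ∩ (el (ref L)).mapCell (map L))
  /-- the nodes of one element that lie in another one are nodes of the latter as well -/
  node_match : ∀ K L i, (el (ref K)).mapNode (map K) i ∈ (el (ref L)).mapCell (map L) →
    ∃ j, (el (ref L)).mapNode (map L) j = (el (ref K)).mapNode (map K) i
  /-- on a common face, a function of the local space is determined by its values at the nodes in
  that face, in the same way on both sides -/
  trace_match : ∀ K L, ∀ P ∈ (el (ref K)).mapSpace (map K), ∀ Q ∈ (el (ref L)).mapSpace (map L),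
    (∀ i, (el (ref K)).mapNode (map K) i ∈ (el (ref L)).mapCell (map L) →
      evalAt P ((el (ref K)).mapNode (map K) i) = evalAt Q ((el (ref K)).mapNode (map K) i)) →
    ∀ x ∈ (el (ref K)).mapCell (map K) ∩ (el (ref L)).mapCell (map L), evalAt P x = evalAt Q x
  /-- the boundary is resolved by the mesh: a function of the local space that vanishes at the
  boundary nodes vanishes on the boundary -/
  trace_boundary : ∀ K, ∀ P ∈ (el (ref K)).mapSpace (map K),
    (∀ i, (el (ref K)).mapNode (map K) i ∈ frontier Ω →
      evalAt P ((el (ref K)).mapNode (map K) i) = 0) →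
    ∀ x ∈ (el (ref K)).mapCell (map K) ∩ frontier Ω, evalAt P x = 0

namespace Mesh

attribute [instance] Mesh.fintype

variable {Ω : Set E3} {p : ℕ} {R : Type} {el : R → LagrangeElement p} (T : Mesh Ω el)

/-- The element with index `K`, as a subset of space. -/
def cell (K : T.ι) : Set E3 := (el (T.ref K)).mapCell (T.map K)

/-- The local polynomial space `N_p(K)`. -/
def space (K : T.ι) : Set (MvPolynomial (Fin 3) ℂ) := (el (T.ref K)).mapSpace (T.map K)

/-- The mesh size `h`: the largest diameter of an element. -/
def size : ℝ := ⨆ K, Metric.diam (T.cell K)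

/-- Shape regularity: each element `K` contains a ball of radius `diam K / σ`. -/
def ShapeRegular (σ : ℝ) : Prop :=
  ∀ K, ∃ c, Metric.closedBall c (Metric.diam (T.cell K) / σ) ⊆ T.cell K

/-- The finite element space `V_h` with homogeneous Dirichlet condition. A piecewise polynomial
function is given by its polynomials on the elements; it is in `V_h` if these are in the local
spaces, the function is well-defined (hence continuous) on the closure of `Ω`, and it vanishes on
the boundary. -/
def Vh : Set (T.ι → MvPolynomial (Fin 3) ℂ) :=
  {v | (∀ K, v K ∈ T.space K) ∧
    (∀ K L, ∀ x ∈ T.cell K ∩ T.cell L, evalAt (v K) x = evalAt (v L) x) ∧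
    ∀ K, ∀ x ∈ T.cell K ∩ frontier Ω, evalAt (v K) x = 0}

variable (q : ∀ r, Quadrature (el r))

/-- The quadrature points of the element `K`. -/
def qpoint (K : T.ι) (i : Fin (q (T.ref K)).m) : E3 := T.map K ((q (T.ref K)).point i)

/-- The quadrature weights of the element `K`. -/
def qweight (K : T.ι) (i : Fin (q (T.ref K)).m) : ℝ :=
  |LinearMap.det ((T.map K).linear : E3 →ₗ[ℝ] E3)| * (q (T.ref K)).weight i

/-- Functions on the set of pairs (element, quadrature point of that element). -/
abbrev GridFun (α : Type) : Type := ∀ K : T.ι, Fin (q (T.ref K)).m → α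

/-- The discrete inner product `(f, g)_h`, the quadrature of `f^* g`. -/
def hInner (f g : T.GridFun q ℂ) : ℂ :=
  ∑ K, ∑ i, (T.qweight q K i : ℂ) * (conj (f K i) * g K i)

/-- The square of the weighted discrete norm, `‖f‖²_{b,h} = (b f, f)_h`. -/
def hNormSq (b : T.GridFun q ℝ) (f : T.GridFun q ℂ) : ℝ :=
  ∑ K, ∑ i, T.qweight q K i * (b K i * ‖f K i‖ ^ 2)

/-- Values at the quadrature points of a piecewise polynomial. -/
def val (v : T.ι → MvPolynomial (Fin 3) ℂ) : T.GridFun q ℂ :=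
  fun K i => evalAt (v K) (T.qpoint q K i)

/-- Values at the quadrature points of the partial derivative `∂v/∂η` of a piecewise polynomial. -/
def dval (η : Fin 3) (v : T.ι → MvPolynomial (Fin 3) ℂ) : T.GridFun q ℂ :=
  fun K i => evalAt (pderiv η (v K)) (T.qpoint q K i)

/-- Values of `S_η` at the quadrature points. -/
def sval (d : Fin 3 → ℝ → ℝ) (s : ℂ) (η : Fin 3) : T.GridFun q ℂ :=
  fun K i => stretch d s η (T.qpoint q K i)

/-- A choice, at each quadrature point, of a material subdomain whose closure contains the point:
unique except on material interfaces, where it selects the one-sided value that is used. -/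
structure Sampling (M : Medium Ω) where
  side : T.GridFun q M.J
  mem : ∀ K i, T.qpoint q K i ∈ closure (M.sub (side K i))

variable {T q} {M : Medium Ω}

/-- Values of `κ` at the quadrature points. -/
def Sampling.kappa (m : T.Sampling q M) : T.GridFun q ℝ :=
  fun K i => M.kappa (m.side K i) (T.qpoint q K i)

/-- Values of `ρ` at the quadrature points. -/
def Sampling.rho (m : T.Sampling q M) : T.GridFun q ℝ :=
  fun K i => M.rho (m.side K i) (T.qpoint q K i)

/-- The reduced discrete weak form in Laplace space,
`(s² S_x S_y S_z / κ u, v)_h = - (1/ρ 𝐒 ∇_d u, ∇ v)_h + (1/κ F, v)_h` for all `v` in `V_h`, where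
`𝐒 = diag (S_y S_z, S_x S_z, S_x S_y)` and `∇_d = (S_x⁻¹ ∂_x, S_y⁻¹ ∂_y, S_z⁻¹ ∂_z)`. The source is
given by its values at the quadrature points of each element. -/
def ReducedWeakForm (m : T.Sampling q M) (d : Fin 3 → ℝ → ℝ) (s : ℂ) (F : T.GridFun q ℂ)
    (u : T.ι → MvPolynomial (Fin 3) ℂ) : Prop :=
  ∀ v ∈ T.Vh,
    T.hInner q
        (fun K i => s ^ 2 * (∏ η, T.sval q d s η K i) / (m.kappa K i : ℂ) * T.val q u K i)
        (T.val q v) =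
      - (∑ η, T.hInner q
          (fun K i => 1 / (m.rho K i : ℂ) * (∏ ζ ∈ Finset.univ.erase η, T.sval q d s ζ K i) *
            (1 / T.sval q d s η K i * T.dval q η u K i))
          (T.dval q η v))
      + T.hInner q (fun K i => 1 / (m.kappa K i : ℂ) * F K i) (T.val q v)

/-- The energy `E_{u_h}`, where
`E_{u_h}² = ‖s u‖²_{1/κ,h} + ∑_η ‖S_η⁻¹ ∂u/∂η‖²_{1/ρ,h}`. -/
def solutionEnergy (m : T.Sampling q M) (d : Fin 3 → ℝ → ℝ) (s : ℂ)
    (u : T.ι → MvPolynomial (Fin 3) ℂ) : ℝ :=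
  √(T.hNormSq q (fun K i => 1 / m.kappa K i) (fun K i => s * T.val q u K i) +
    ∑ η, T.hNormSq q (fun K i => 1 / m.rho K i)
      (fun K i => 1 / T.sval q d s η K i * T.dval q η u K i))

/-- The energy of the data `E_{f_h}`, where `E_{f_h}² = ‖F‖²_{1/κ,h}`. -/
def dataEnergy (m : T.Sampling q M) (F : T.GridFun q ℂ) : ℝ :=
  √(T.hNormSq q (fun K i => 1 / m.kappa K i) F)

end Mesh

end PML

end

/-! The continuous argument tests the weak form with `s * g * u`, where `g` is the inverse of the
conjugate of `S_x S_y S_z`. The stretching factors then cancel: the mass term becomes `conj s` times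
`|s u|² / κ`, and each stiffness term becomes `s S_η / conj S_η` times `|S_η⁻¹ ∂_η u|² / ρ`. Both
factors have real part at least `Re s` (`re_le_re_mul_stretch_div_conj`). What remains is a cross
term with the gradient of `g`, hence with `d_η'`. Since `2 d_η ≤ |s| |S_η|²`, it costs only `β / 2`
times the energy, not `β` (`re_weakForm_ge`).

In the discrete problem `g u` is not in the finite element space and is replaced elementwise by its
nodal interpolant, which is admissible because `g` is a single-valued function of position
(`mem_Vh_of_node_eq`). The interpolation error is small relative to `u` itself
(`exists_interpolant`): subtracting `g(x) u` and `u(x)` times the affine Taylor part of `g` leaves a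
polynomial with small nodal values, and the inverse estimate then bounds its gradient. By the
Interpolation Condition, and because the local space is stable under derivatives, `u` and its
gradient are controlled by their own values at the quadrature points, so the error is a small
multiple of the discrete energy (`exists_testFunction`). The increments of `g` carry a factor `1 /
|s|`, which makes the bounds uniform in `s` as long as `|s|` stays away from zero. Only continuity
of `d_η'` is used, through its oscillation on an element.

If `β > 0` and `h` is below a threshold, the error is absorbed by the unused `β / 2`, and `β_h = β`.
On coarser meshes `h` is bounded below, so `β_h` may exceed `β` by a fixed constant, which a large
`C` makes at most `C h ^ (p - 1)`. If `β = 0`, all `d_η'` vanish on the closure of `Ω`, `g` is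
constant there, and the error terms vanish. -/

namespace PML

/-! ### Polynomials along lines and under affine maps. -/

section Polynomials

variable (P Q : MvPolynomial (Fin 3) ℂ) (x : E3)

theorem evalAt_add : evalAt (P + Q) x = evalAt P x + evalAt Q x := by simp [evalAt]
theorem evalAt_sub : evalAt (P - Q) x = evalAt P x - evalAt Q x := by simp [evalAt]
theorem evalAt_mul : evalAt (P * Q) x = evalAt P x * evalAt Q x := by simp [evalAt]
theorem evalAt_smul (c : ℂ) : evalAt (c • P) x = c * evalAt P x := by simp [evalAt]
theorem evalAt_C (c : ℂ) : evalAt (C c) x = c := by simp [evalAt]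
theorem evalAt_X (i : Fin 3) : evalAt (X i) x = (x i : ℂ) := by simp [evalAt]
theorem evalAt_zero : evalAt 0 x = 0 := by simp [evalAt]
theorem evalAt_sum {α : Type*} (t : Finset α) (f : α → MvPolynomial (Fin 3) ℂ) :
    evalAt (∑ j ∈ t, f j) x = ∑ j ∈ t, evalAt (f j) x := by simp [evalAt]

theorem continuous_evalAt : Continuous (evalAt P) := by
  have := MvPolynomial.continuous_eval P
  unfold evalAt
  fun_prop

/-- The derivative of a polynomial along a line. -/
theorem hasDerivAt_evalAt_line (v : E3) (t : ℝ) :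
    HasDerivAt (fun t : ℝ => evalAt P (x + t • v))
      (∑ η, (v η : ℂ) * evalAt (pderiv η P) (x + t • v)) t := by
  induction P using MvPolynomial.induction_on with
  | C a => simpa [evalAt_C, evalAt_zero] using hasDerivAt_const t a
  | add P Q hP hQ =>
    have := hP.add hQ
    simp only [map_add, evalAt_add, mul_add, Finset.sum_add_distrib]
    exact this
  | mul_X P i hP =>
    have h1 : HasDerivAt (fun t : ℝ => evalAt (X i) (x + t • v)) (v i : ℂ) t := by
      simp only [evalAt_X]
      have : HasDerivAt (fun t : ℝ => (x + t • v) i) (v i) t := by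
        simpa using ((hasDerivAt_id t).mul_const (v i)).const_add (x i)
      exact this.ofReal_comp
    have h2 : HasDerivAt (fun t : ℝ => evalAt P (x + t • v) * evalAt (X i) (x + t • v)) _ t :=
      hP.mul h1
    have h3 : ∑ η, (v η : ℂ) * evalAt (pderiv η (P * X i)) (x + t • v) =
        (∑ η, (v η : ℂ) * evalAt (pderiv η P) (x + t • v)) * evalAt (X i) (x + t • v) +
          evalAt P (x + t • v) * (v i : ℂ) := by
      have h4 : ∀ η : Fin 3, (v η : ℂ) * evalAt (pderiv η (P * X i)) (x + t • v) =
          (v η : ℂ) * evalAt (pderiv η P) (x + t • v) * evalAt (X i) (x + t • v) +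
            (if i = η then (v η : ℂ) * evalAt P (x + t • v) else 0) := by
        intro η
        rw [Derivation.leibniz, pderiv_X]
        by_cases h : i = η
        · subst h
          simp [evalAt_add, evalAt_mul]; ring
        · simp [evalAt_mul, h]; ring
      rw [Finset.sum_congr rfl fun η _ => h4 η, Finset.sum_add_distrib, Finset.sum_mul]
      simp [mul_comm]
    simp only [← evalAt_mul] at h2
    rw [h3]
    exact h2

/-- Mean value inequality for polynomials on a convex set. -/
theorem norm_evalAt_sub_le {s : Set E3} (hs : Convex ℝ s) {c : ℝ}
    (hc : ∀ y ∈ s, ∀ η, ‖evalAt (pderiv η P) y‖ ≤ c) {x y : E3} (hx : x ∈ s) (hy : y ∈ s) :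
    ‖evalAt P y - evalAt P x‖ ≤ 3 * c * dist y x := by
  have h := fun t : ℝ => hasDerivAt_evalAt_line P x (y - x) t
  have hb : ∀ t ∈ Set.Ico (0 : ℝ) 1,
      ‖∑ η, ((y - x) η : ℂ) * evalAt (pderiv η P) (x + t • (y - x))‖ ≤ 3 * c * dist y x := by
    intro t ht
    have hm : x + t • (y - x) ∈ s := hs.add_smul_sub_mem hx hy ⟨ht.1, ht.2.le⟩
    calc _ ≤ ∑ _η : Fin 3, dist y x * c := by
          refine norm_sum_le_of_le _ fun η _ => ?_
          rw [norm_mul]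
          refine mul_le_mul ?_ (hc _ hm η) (norm_nonneg _) dist_nonneg
          rw [Complex.norm_real, dist_eq_norm]
          exact PiLp.norm_apply_le (y - x) η
      _ = 3 * c * dist y x := by simp; ring
  have := norm_image_sub_le_of_norm_deriv_le_segment_01'
    (fun t _ => (h t).hasDerivWithinAt) hb
  simpa using this

variable {P Q x} in
/-- The chain rule for a polynomial pulled back by an affine map. -/
theorem evalAt_pderiv_of_comp (A : E3 ≃ᵃ[ℝ] E3) (h : ∀ x, evalAt P (A x) = evalAt Q x)
    (η : Fin 3) :
    evalAt (pderiv η P) (A x) =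
      ∑ ζ, (((A.symm.linear (EuclideanSpace.single η 1)) ζ : ℝ) : ℂ) *
        evalAt (pderiv ζ Q) x := by
  have h1 := hasDerivAt_evalAt_line P (A x) (EuclideanSpace.single η (1 : ℝ)) 0
  have h2 := hasDerivAt_evalAt_line Q x (A.symm.linear (EuclideanSpace.single η (1 : ℝ))) 0
  -- `A` maps the line through `x` with direction `A⁻¹ e_η` to the line through `A x` with direction
  -- `e_η`. Uniqueness of the derivative along it is the chain rule.
  have h3 : (fun t : ℝ => evalAt P (A x + t • EuclideanSpace.single η (1 : ℝ))) =
      fun t : ℝ => evalAt Q (x + t • A.symm.linear (EuclideanSpace.single η (1 : ℝ))) := by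
    funext t
    rw [← h]
    congr 1
    have := A.map_vadd x (t • A.symm.linear (EuclideanSpace.single η (1 : ℝ)))
    rw [vadd_eq_add, vadd_eq_add] at this
    rw [add_comm x, this, add_comm]
    rw [map_smul]
    exact congrArg (fun w => t • w + A x) (A.linear.apply_symm_apply _).symm
  rw [h3] at h1
  have := h1.unique h2
  simpa [Finset.sum_ite_eq, ite_mul, apply_ite] using this

/-- An affine map of three-space in coordinates. -/
theorem affine_apply (A : E3 ≃ᵃ[ℝ] E3) (y : E3) (i : Fin 3) :
    A y i = A 0 i + ∑ j, y j * A.linear (EuclideanSpace.single j 1) i := by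
  have h1 := A.map_vadd 0 y
  have h2 : y = ∑ j, y j • EuclideanSpace.single j (1 : ℝ) := by
    ext k; simp [Pi.single_apply]
  rw [vadd_eq_add, add_zero, vadd_eq_add, add_comm] at h1
  have h3 : A.linear y = ∑ j, y j • A.linear (EuclideanSpace.single j 1) := by
    conv_lhs => rw [h2]
    simp
  rw [h1, h3]
  simp

/-- A polynomial that represents the composition with an affine map. -/
theorem exists_evalAt_comp (A : E3 ≃ᵃ[ℝ] E3) :
    ∃ P, ∀ x, evalAt P (A x) = evalAt Q x := by
  let L := A.symm.linear
  refine ⟨bind₁ (fun i => C ((A.symm 0 i : ℝ) : ℂ) +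
    ∑ j, C (((L (EuclideanSpace.single j 1)) i : ℝ) : ℂ) * X j) Q, fun x => ?_⟩
  have key : ∀ y : E3, evalAt (bind₁ (fun i => C ((A.symm 0 i : ℝ) : ℂ) +
    ∑ j, C (((L (EuclideanSpace.single j 1)) i : ℝ) : ℂ) * X j) Q) y = evalAt Q (A.symm y) := by
    intro y
    unfold evalAt
    rw [← MvPolynomial.coe_aeval_eq_eval, RingHom.coe_coe, aeval_bind₁,
      ← MvPolynomial.coe_aeval_eq_eval, RingHom.coe_coe]
    congr 2
    funext i
    rw [affine_apply A.symm y i]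
    push_cast
    simp [mul_comm, L]
  rw [key]
  simp

end Polynomials

/-! ### Uniform constants for the reference elements. -/

/-- Polynomials in a unisolvent space and their derivatives are bounded on a compact set by their
nodal values. -/
theorem eventually_bound_of_unisolvent (V : Submodule ℂ (MvPolynomial (Fin 3) ℂ)) {n : ℕ}
    (z : Fin n → E3)
    (uni : ∀ c : Fin n → ℂ, ∃! P : MvPolynomial (Fin 3) ℂ, P ∈ V ∧ ∀ i, evalAt P (z i) = c i)
    {S : Set E3} (hS : IsCompact S) :
    ∀ᶠ c : ℝ in Filter.atTop, ∀ Q ∈ V, ∀ x ∈ S,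
      ‖evalAt Q x‖ ≤ c * ∑ j, ‖evalAt Q (z j)‖ ∧
      ∀ η, ‖evalAt (pderiv η Q) x‖ ≤ c * ∑ j, ‖evalAt Q (z j)‖ := by
  choose L hL _ using fun j : Fin n => uni (Pi.single j 1)
  have hbd : ∀ P : MvPolynomial (Fin 3) ℂ, ∀ᶠ c : ℝ in Filter.atTop, ∀ x ∈ S,
      ‖evalAt P x‖ ≤ c := by
    intro P
    obtain ⟨b, hb⟩ := hS.exists_bound_of_continuousOn (continuous_evalAt P).continuousOn
    filter_upwards [Filter.eventually_ge_atTop b] with c hc x hx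
    exact (hb x hx).trans hc
  have h1 : ∀ᶠ c : ℝ in Filter.atTop, ∀ j, ∀ x ∈ S, ‖evalAt (L j) x‖ ≤ c :=
    Filter.eventually_all.2 fun j => hbd _
  have h2 : ∀ᶠ c : ℝ in Filter.atTop, ∀ j η, ∀ x ∈ S, ‖evalAt (pderiv η (L j)) x‖ ≤ c :=
    Filter.eventually_all.2 fun j => Filter.eventually_all.2 fun η => hbd _
  filter_upwards [h1, h2] with c h1 h2 Q hQ x hx
  -- Unisolvence gives the Lagrange expansion, so it is enough to bound the finitely many basis
  -- polynomials and their derivatives.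
  have hexp : Q = ∑ j, evalAt Q (z j) • L j := by
    refine (uni fun i => evalAt Q (z i)).unique ⟨hQ, fun _ => rfl⟩
      ⟨V.sum_mem fun j _ => V.smul_mem _ (hL j).1, fun i => ?_⟩
    rw [evalAt_sum]
    simp [evalAt_smul, (hL _).2, Pi.single_apply]
  constructor
  · conv_lhs => rw [hexp]
    rw [evalAt_sum, Finset.mul_sum]
    refine norm_sum_le_of_le _ fun j _ => ?_
    rw [evalAt_smul, norm_mul, mul_comm]
    exact mul_le_mul_of_nonneg_right (h1 j x hx) (norm_nonneg _)
  · intro η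
    conv_lhs => rw [hexp]
    rw [map_sum, evalAt_sum, Finset.mul_sum]
    refine norm_sum_le_of_le _ fun j _ => ?_
    rw [Derivation.map_smul, evalAt_smul, norm_mul, mul_comm]
    exact mul_le_mul_of_nonneg_right (h2 j η x hx) (norm_nonneg _)

/-- A bound for all constants that belong to a reference element with its quadrature. -/
structure RefBound {p : ℕ} (e : LagrangeElement p) (q : Quadrature e) (c : ℝ) : Prop where
  one_le : 1 ≤ c
  n_le : (e.n : ℝ) ≤ c
  m_le : (q.m : ℝ) ≤ c
  dist_le : ∀ x ∈ e.cell, ∀ y ∈ e.cell, dist x y ≤ c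
  weight_le : ∀ i, q.weight i ≤ c
  one_le_weight : ∀ i, 1 ≤ c * q.weight i
  node_bound : ∀ Q ∈ e.space, ∀ x ∈ e.cell,
    ‖evalAt Q x‖ ≤ c * ∑ j, ‖evalAt Q (e.node j)‖ ∧
    ∀ η, ‖evalAt (pderiv η Q) x‖ ≤ c * ∑ j, ‖evalAt Q (e.node j)‖
  point_bound : ∀ Q ∈ e.space, ∀ x ∈ e.cell,
    ‖evalAt Q x‖ ≤ c * ∑ j, ‖evalAt Q (q.point j)‖ ∧
    ∀ η, ‖evalAt (pderiv η Q) x‖ ≤ c * ∑ j, ‖evalAt Q (q.point j)‖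

/-- Asking for all large `c` lets the conditions of finitely many reference elements be intersected,
so that a single constant serves the whole mesh. -/
theorem eventually_refBound {p : ℕ} (e : LagrangeElement p) (q : Quadrature e)
    (hq : InterpolationCondition q) : ∀ᶠ c : ℝ in Filter.atTop, RefBound e q c := by
  have hcpt : IsCompact e.cell := e.vertices.finite_toSet.isCompact_convexHull ℝ
  obtain ⟨D, hD⟩ := Metric.isBounded_iff.1 hcpt.isBounded
  have hw : ∀ᶠ c : ℝ in Filter.atTop, ∀ i, q.weight i ≤ c ∧ 1 ≤ c * q.weight i := by
    refine Filter.eventually_all.2 fun i => ?_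
    filter_upwards [Filter.eventually_ge_atTop (q.weight i),
      Filter.eventually_ge_atTop (1 / q.weight i)] with c h1 h2
    exact ⟨h1, (div_le_iff₀ (q.weight_pos i)).1 h2⟩
  filter_upwards [Filter.eventually_ge_atTop 1, Filter.eventually_ge_atTop (e.n : ℝ),
    Filter.eventually_ge_atTop (q.m : ℝ), Filter.eventually_ge_atTop D, hw,
    eventually_bound_of_unisolvent e.space e.node e.unisolvent hcpt,
    eventually_bound_of_unisolvent e.space q.point hq hcpt] with c h1 h2 h3 h4 h5 h6 h7
  exact ⟨h1, h2, h3, fun x hx y hy => (hD hx hy).trans h4, fun i => (h5 i).1, fun i => (h5 i).2,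
    h6, h7⟩

/-! ### Affine images of elements and inverse estimates. -/

namespace LagrangeElement

variable {p : ℕ} {e : LagrangeElement p}

theorem C_mem_space (c : ℂ) : C c ∈ e.space :=
  e.order_le (by simp [mem_restrictTotalDegree])

theorem X_mem_space (hp : 1 ≤ p) (i : Fin 3) : X i ∈ e.space :=
  e.order_le (by simpa [mem_restrictTotalDegree, totalDegree_X] using hp)

/-- Affine functions are in the local polynomial space of an element. -/
theorem affine_mem_mapSpace (hp : 1 ≤ p) (A : E3 ≃ᵃ[ℝ] E3) (a : Fin 3 → ℂ) (y : E3) :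
    ∑ η, a η • (X η - C (y η : ℂ)) ∈ e.mapSpace A := by
  refine ⟨∑ η, a η • (C (A 0 η : ℂ) +
    ∑ j, (((A.linear (EuclideanSpace.single j 1)) η : ℝ) : ℂ) • X j - C (y η : ℂ)), ?_, ?_⟩
  · refine e.space.sum_mem fun η _ => e.space.smul_mem _ (e.space.sub_mem (e.space.add_mem
      (C_mem_space _) (e.space.sum_mem fun j _ => e.space.smul_mem _ (X_mem_space hp _)))
      (C_mem_space _))
  · intro x
    simp only [evalAt_sum, evalAt_smul, evalAt_sub, evalAt_add, evalAt_C, evalAt_X]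
    refine Finset.sum_congr rfl fun η _ => ?_
    rw [affine_apply A x η]
    push_cast
    simp [mul_comm]

theorem sub_mem_mapSpace {A : E3 ≃ᵃ[ℝ] E3} {P Q : MvPolynomial (Fin 3) ℂ}
    (hP : P ∈ e.mapSpace A) (hQ : Q ∈ e.mapSpace A) : P - Q ∈ e.mapSpace A := by
  obtain ⟨P', hP', h⟩ := hP
  obtain ⟨Q', hQ', h'⟩ := hQ
  exact ⟨P' - Q', e.space.sub_mem hP' hQ', fun x => by rw [evalAt_sub, evalAt_sub, h, h']⟩

theorem smul_mem_mapSpace {A : E3 ≃ᵃ[ℝ] E3} {P : MvPolynomial (Fin 3) ℂ} (c : ℂ)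
    (hP : P ∈ e.mapSpace A) : c • P ∈ e.mapSpace A := by
  obtain ⟨P', hP', h⟩ := hP
  exact ⟨c • P', e.space.smul_mem _ hP', fun x => by rw [evalAt_smul, evalAt_smul, h]⟩

/-- By the chain rule the pull-back of a derivative is a combination of derivatives of the
pull-back. Hence `∂u` is bounded by its own quadrature values, without the factor `1 / h` of an
inverse estimate. -/
theorem pderiv_mem_mapSpace {A : E3 ≃ᵃ[ℝ] E3} {P : MvPolynomial (Fin 3) ℂ} (η : Fin 3)
    (hP : P ∈ e.mapSpace A) : pderiv η P ∈ e.mapSpace A := by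
  obtain ⟨P', hP', h⟩ := hP
  refine ⟨∑ ζ, (((A.symm.linear (EuclideanSpace.single η 1)) ζ : ℝ) : ℂ) • pderiv ζ P',
    e.space.sum_mem fun ζ _ => e.space.smul_mem _ (e.pderiv_mem ζ _ hP'), fun x => ?_⟩
  rw [evalAt_pderiv_of_comp A h η, evalAt_sum]
  simp only [evalAt_smul]

theorem convex_mapCell (A : E3 ≃ᵃ[ℝ] E3) : Convex ℝ (e.mapCell A) :=
  (convex_convexHull ℝ _).affine_image (A : E3 →ᵃ[ℝ] E3)

theorem isCompact_mapCell (A : E3 ≃ᵃ[ℝ] E3) : IsCompact (e.mapCell A) :=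
  (e.vertices.finite_toSet.isCompact_convexHull ℝ).image
    (A : E3 →ᵃ[ℝ] E3).continuous_of_finiteDimensional

theorem mapNode_mem (A : E3 ≃ᵃ[ℝ] E3) (i : Fin e.n) : e.mapNode A i ∈ e.mapCell A :=
  ⟨_, e.node_mem i, rfl⟩

/-- There is a function of the local space with given nodal values. -/
theorem exists_mapSpace_node_eq (A : E3 ≃ᵃ[ℝ] E3) (a : Fin e.n → ℂ) :
    ∃ v ∈ e.mapSpace A, ∀ i, evalAt v (e.mapNode A i) = a i := by
  obtain ⟨Q, ⟨hQ, hQa⟩, -⟩ := e.unisolvent a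
  obtain ⟨P, hP⟩ := exists_evalAt_comp Q A
  exact ⟨P, ⟨Q, hQ, hP⟩, fun i => (hP _).trans (hQa i)⟩

/-- Inverse estimate for the affine map of a shape regular element. -/
theorem diam_mul_norm_symm_le {A : E3 ≃ᵃ[ℝ] E3} {q : Quadrature e} {c σ : ℝ}
    (hc : RefBound e q c) (hσ : 0 < σ) {y : E3}
    (h : Metric.closedBall y (Metric.diam (e.mapCell A) / σ) ⊆ e.mapCell A) (η : Fin 3) :
    Metric.diam (e.mapCell A) * ‖A.symm.linear (EuclideanSpace.single η 1)‖ ≤ c * σ := by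
  set D := Metric.diam (e.mapCell A)
  have hD : 0 ≤ D / σ := div_nonneg Metric.diam_nonneg hσ.le
  have hmem : ∀ z ∈ e.mapCell A, A.symm z ∈ e.cell := by
    rintro _ ⟨x, hx, rfl⟩
    simpa using hx
  -- The centre of the inscribed ball, and the point at distance one radius from it in direction
  -- `e_η`, both pull back into the reference cell, whose diameter is at most `c`.
  have h1 := hmem _ (h (Metric.mem_closedBall_self hD))
  have h2 := hmem (y + (D / σ) • EuclideanSpace.single η 1) (h (by
    rw [mem_closedBall_iff_norm, add_sub_cancel_left, norm_smul, Real.norm_of_nonneg hD]; simp))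
  have h3 := hc.dist_le _ h2 _ h1
  have h4 := A.symm.map_vadd y ((D / σ) • EuclideanSpace.single η 1)
  rw [vadd_eq_add, vadd_eq_add, add_comm] at h4
  rw [h4, dist_eq_norm, add_sub_cancel_right, map_smul, norm_smul, Real.norm_of_nonneg hD] at h3
  calc _ = D / σ * ‖A.symm.linear (EuclideanSpace.single η 1)‖ * σ := by field_simp
    _ ≤ _ := mul_le_mul_of_nonneg_right h3 hσ.le

section Bounds

variable {q : Quadrature e} {c : ℝ} (hc : RefBound e q c) {A : E3 ≃ᵃ[ℝ] E3}
  {P : MvPolynomial (Fin 3) ℂ} (hP : P ∈ e.mapSpace A) {x : E3} (hx : x ∈ e.mapCell A)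
include hc hP hx

theorem norm_evalAt_le_points : ‖evalAt P x‖ ≤ c * ∑ i, ‖evalAt P (A (q.point i))‖ := by
  obtain ⟨Q, hQ, h⟩ := hP
  obtain ⟨x, hx, rfl⟩ := hx
  simpa only [h] using (hc.point_bound Q hQ x hx).1

theorem norm_evalAt_le_nodes : ‖evalAt P x‖ ≤ c * ∑ i, ‖evalAt P (e.mapNode A i)‖ := by
  obtain ⟨Q, hQ, h⟩ := hP
  obtain ⟨x, hx, rfl⟩ := hx
  simpa only [mapNode, h] using (hc.node_bound Q hQ x hx).1

/-- The inverse inequality: by shape regularity the factor `‖A⁻¹ e_η‖` is at most of order `1 / diam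
K`. -/
theorem norm_evalAt_pderiv_le_nodes (η : Fin 3) :
    ‖evalAt (pderiv η P) x‖ ≤ 3 * ‖A.symm.linear (EuclideanSpace.single η 1)‖ *
      (c * ∑ i, ‖evalAt P (e.mapNode A i)‖) := by
  obtain ⟨Q, hQ, h⟩ := hP
  obtain ⟨x, hx, rfl⟩ := hx
  rw [evalAt_pderiv_of_comp A h η]
  simp only [mapNode, h]
  calc _ ≤ ∑ _ζ : Fin 3, ‖A.symm.linear (EuclideanSpace.single η 1)‖ *
        (c * ∑ i, ‖evalAt Q (e.node i)‖) := by
        refine norm_sum_le_of_le _ fun ζ _ => ?_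
        rw [norm_mul, Complex.norm_real]
        exact mul_le_mul (PiLp.norm_apply_le _ ζ) ((hc.node_bound Q hQ x hx).2 ζ)
          (norm_nonneg _) (norm_nonneg _)
    _ = _ := by simp; ring

end Bounds

end LagrangeElement

/-! ### Interpolation of a smooth multiple of a discrete function. -/

namespace LagrangeElement

variable {p : ℕ} {e : LagrangeElement p}

/-- Nodal interpolation of `g u`, where `u` is in the local space and `g` is differentiable with
gradient `G`: the interpolant and its derivatives are close to `g u` and its derivatives, relative
to the values of `u` and its derivatives at the quadrature points. -/
theorem exists_interpolant (hp : 1 ≤ p) {q : Quadrature e} {c σ h : ℝ} (hc : RefBound e q c)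
    (hσ : 0 ≤ σ) {A : E3 ≃ᵃ[ℝ] E3} (hdist : ∀ x ∈ e.mapCell A, ∀ y ∈ e.mapCell A, dist x y ≤ h)
    (hA : ∀ η, h * ‖A.symm.linear (EuclideanSpace.single η 1)‖ ≤ c * σ) (h0 : 0 ≤ h)
    {u : MvPolynomial (Fin 3) ℂ} (hu : u ∈ e.mapSpace A) {g : E3 → ℂ} {G : Fin 3 → E3 → ℂ}
    {t₁ t₂ : ℝ} (ht₁ : 0 ≤ t₁) (ht₂ : 0 ≤ t₂)
    (hg : ∀ x ∈ e.mapCell A, ∀ y ∈ e.mapCell A, ‖g x - g y‖ ≤ t₁ * dist x y)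
    (hG : ∀ x ∈ e.mapCell A, ∀ y ∈ e.mapCell A,
      ‖g x - g y - ∑ η, G η y * ((x η : ℂ) - y η)‖ ≤ t₂ * dist x y) :
    ∃ v ∈ e.mapSpace A,
      (∀ j, evalAt v (e.mapNode A j) = g (e.mapNode A j) * evalAt u (e.mapNode A j)) ∧
      ∀ x ∈ e.mapCell A,
        ‖evalAt v x - g x * evalAt u x‖ ≤ 9 * c ^ 4 * (σ + 1) * (h * (t₁ + t₂)) *
          ∑ i, ‖evalAt u (A (q.point i))‖ ∧
        ∀ η, ‖evalAt (pderiv η v) x - (g x * evalAt (pderiv η u) x + G η x * evalAt u x)‖ ≤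
          9 * c ^ 4 * (σ + 1) * (h * t₁ * (∑ i, ∑ ζ, ‖evalAt (pderiv ζ u) (A (q.point i))‖) +
            t₂ * ∑ i, ‖evalAt u (A (q.point i))‖) := by
  obtain ⟨v, hv, hvn⟩ := exists_mapSpace_node_eq (e := e) A
    fun j => g (e.mapNode A j) * evalAt u (e.mapNode A j)
  refine ⟨v, hv, hvn, fun x hx => ?_⟩
  set U := ∑ i, ‖evalAt u (A (q.point i))‖ with hU
  set W := ∑ i, ∑ ζ, ‖evalAt (pderiv ζ u) (A (q.point i))‖ with hW
  have hc1 := hc.one_le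
  have hc0 : 0 ≤ c := by linarith
  have hU0 : 0 ≤ U := Finset.sum_nonneg fun i _ => norm_nonneg _
  have hW0 : 0 ≤ W := Finset.sum_nonneg fun i _ => Finset.sum_nonneg fun ζ _ => norm_nonneg _
  set ℓ : MvPolynomial (Fin 3) ℂ := ∑ η, G η x • (X η - C (x η : ℂ)) with hℓ
  -- With `x` fixed, the value and gradient of `P` at `x` are exactly the two errors to be bounded.
  -- `P` lies in the local space because affine functions do, so its nodal values control both.
  set P := v - g x • u - evalAt u x • ℓ with hPdef
  have hP : P ∈ e.mapSpace A := sub_mem_mapSpace (sub_mem_mapSpace hv (smul_mem_mapSpace _ hu))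
    (smul_mem_mapSpace _ (affine_mem_mapSpace hp A _ x))
  have hℓe : ∀ y : E3, evalAt ℓ y = ∑ η, G η x * ((y η : ℂ) - x η) := fun y => by
    simp [hℓ, evalAt_sum, evalAt_smul, evalAt_sub, evalAt_X, evalAt_C]
  have hPx : evalAt P x = evalAt v x - g x * evalAt u x := by
    simp [hPdef, evalAt_sub, evalAt_smul, hℓe]
  have hℓd : ∀ η, evalAt (pderiv η ℓ) x = G η x := fun η => by
    simp only [hℓ, pderiv_X, Pi.single_apply, Fin.sum_univ_three, Derivation.map_smul, map_add,
      map_sub, pderiv_C]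
    fin_cases η <;> simp [evalAt]
  have hPd : ∀ η, evalAt (pderiv η P) x =
      evalAt (pderiv η v) x - (g x * evalAt (pderiv η u) x + G η x * evalAt u x) := fun η => by
    rw [hPdef, map_sub, map_sub, Derivation.map_smul, Derivation.map_smul, evalAt_sub, evalAt_sub,
      evalAt_smul, evalAt_smul, hℓd]
    ring
  have hux : ∀ y ∈ e.mapCell A, ‖evalAt u y‖ ≤ c * U := fun y hy =>
    norm_evalAt_le_points hc hu hy
  have hdu : ∀ y ∈ e.mapCell A, ∀ η, ‖evalAt (pderiv η u) y‖ ≤ c * W := fun y hy η => by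
    refine (norm_evalAt_le_points hc (pderiv_mem_mapSpace η hu) hy).trans ?_
    refine mul_le_mul_of_nonneg_left (Finset.sum_le_sum fun i _ => ?_) hc0
    exact Finset.single_le_sum (f := fun ζ => ‖evalAt (pderiv ζ u) (A (q.point i))‖)
      (fun _ _ => norm_nonneg _) (Finset.mem_univ η)
  -- The bound `b` for the variation of `u` stays free: a crude one suffices for the value, but the
  -- gradient needs one of order `h`.
  have hnode : ∀ b : ℝ, (∀ y ∈ e.mapCell A, ‖evalAt u y - evalAt u x‖ ≤ b) →
      ∑ j, ‖evalAt P (e.mapNode A j)‖ ≤ c * (h * (t₁ * b + t₂ * (c * U))) := by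
    intro b hb
    have hb0 : 0 ≤ b := (norm_nonneg _).trans (hb x hx)
    have hj : ∀ j, ‖evalAt P (e.mapNode A j)‖ ≤ h * (t₁ * b + t₂ * (c * U)) := by
      intro j
      set z := e.mapNode A j with hz
      have hzm : z ∈ e.mapCell A := mapNode_mem A j
      -- The nodal value is a product of two increments plus the Taylor remainder of `g` times `u
      -- x`.
      have hPz : evalAt P z = (g z - g x) * (evalAt u z - evalAt u x) +
          (g z - g x - ∑ η, G η x * ((z η : ℂ) - x η)) * evalAt u x := by
        rw [hPdef, evalAt_sub, evalAt_sub, evalAt_smul, evalAt_smul, hℓe, hvn]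
        ring
      rw [hPz]
      have h1 : ‖(g z - g x) * (evalAt u z - evalAt u x)‖ ≤ t₁ * h * b := by
        rw [norm_mul]
        exact mul_le_mul ((hg z hzm x hx).trans
          (mul_le_mul_of_nonneg_left (hdist z hzm x hx) ht₁)) (hb z hzm) (norm_nonneg _)
          (by positivity)
      have h2 : ‖(g z - g x - ∑ η, G η x * ((z η : ℂ) - x η)) * evalAt u x‖ ≤
          t₂ * h * (c * U) := by
        rw [norm_mul]
        exact mul_le_mul ((hG z hzm x hx).trans
          (mul_le_mul_of_nonneg_left (hdist z hzm x hx) ht₂)) (hux x hx) (norm_nonneg _)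
          (by positivity)
      calc _ ≤ t₁ * h * b + t₂ * h * (c * U) := (norm_add_le _ _).trans (add_le_add h1 h2)
        _ = _ := by ring
    calc _ ≤ ∑ _j : Fin e.n, h * (t₁ * b + t₂ * (c * U)) := Finset.sum_le_sum fun j _ => hj j
      _ = e.n * (h * (t₁ * b + t₂ * (c * U))) := by simp
      _ ≤ _ := mul_le_mul_of_nonneg_right hc.n_le (by positivity)
  constructor
  · rw [← hPx]
    have h1 := hnode (2 * (c * U)) fun y hy => (norm_sub_le _ _).trans (by
      linarith [hux y hy, hux x hx])
    calc _ ≤ c * ∑ j, ‖evalAt P (e.mapNode A j)‖ := norm_evalAt_le_nodes hc hP hx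
      _ ≤ c * (c * (h * (t₁ * (2 * (c * U)) + t₂ * (c * U)))) :=
        mul_le_mul_of_nonneg_left h1 hc0
      _ = c ^ 3 * 1 * (h * (2 * t₁ + t₂)) * U := by ring
      _ ≤ c ^ 4 * (σ + 1) * (h * (9 * t₁ + 9 * t₂)) * U := by
        have h34 : c ^ 3 ≤ c ^ 4 := pow_le_pow_right₀ hc1 (by norm_num)
        exact mul_le_mul_of_nonneg_right (mul_le_mul (mul_le_mul h34 (by linarith) zero_le_one
          (by positivity)) (mul_le_mul_of_nonneg_left (by linarith) h0) (by positivity)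
          (by positivity)) hU0
      _ = _ := by ring
  · intro η
    rw [← hPd]
    -- The mean value inequality supplies a factor `h`. The other factor `h`, already in `hnode`,
    -- cancels the loss `‖A⁻¹ e_η‖` of the inverse inequality through `hA`.
    have h1 := hnode (3 * (c * W) * h) fun y hy =>
      (norm_evalAt_sub_le u (convex_mapCell A) hdu hx hy).trans
        (mul_le_mul_of_nonneg_left (hdist y hy x hx) (by positivity))
    set B := ‖A.symm.linear (EuclideanSpace.single η 1)‖ with hB
    calc _ ≤ 3 * B * (c * ∑ i, ‖evalAt P (e.mapNode A i)‖) :=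
          norm_evalAt_pderiv_le_nodes hc hP hx η
      _ ≤ 3 * B * (c * (c * (h * (t₁ * (3 * (c * W) * h) + t₂ * (c * U))))) := by gcongr
      _ = (h * B) * (3 * c ^ 3 * (3 * (h * t₁ * W) + t₂ * U)) := by ring
      _ ≤ (c * σ) * (3 * c ^ 3 * (3 * (h * t₁ * W) + t₂ * U)) := by
        exact mul_le_mul_of_nonneg_right (hA η) (by positivity)
      _ = 3 * c ^ 4 * σ * (3 * (h * t₁ * W) + t₂ * U) := by ring
      _ ≤ 3 * c ^ 4 * (σ + 1) * (3 * (h * t₁ * W) + 3 * (t₂ * U)) := by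
        have : 0 ≤ t₂ * U := by positivity
        exact mul_le_mul (mul_le_mul_of_nonneg_left (by linarith) (by positivity)) (by linarith)
          (by positivity) (by positivity)
      _ = _ := by ring

end LagrangeElement

/-! ### The stretching factor in the right half-plane. -/

section Stretch

variable {s : ℂ} (hs : 0 < s.re)
include hs

/-- In the right half-plane `Re (t / s) ≥ 0`, so already the real part is at least one. -/
theorem one_le_norm_stretch {t : ℝ} (ht : 0 ≤ t) : 1 ≤ ‖1 + (t : ℂ) / s‖ := by
  refine le_trans ?_ (Complex.re_le_norm _)
  rw [Complex.add_re, Complex.div_re]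
  simp only [Complex.one_re, Complex.ofReal_re, Complex.ofReal_im, zero_mul, zero_div, add_zero]
  have : 0 ≤ t * s.re / Complex.normSq s :=
    div_nonneg (mul_nonneg ht hs.le) (Complex.normSq_nonneg _)
  linarith

theorem stretch_ne_zero {t : ℝ} (ht : 0 ≤ t) : 1 + (t : ℂ) / s ≠ 0 :=
  norm_pos_iff.1 (zero_lt_one.trans_le (one_le_norm_stretch hs ht))

theorem ne_zero_of_re_pos : s ≠ 0 := fun h => by simp [h] at hs

/-- `2 d ≤ |s| |S|²`, where `S = 1 + d / s`. -/
theorem two_mul_le_norm_mul_norm_stretch_sq {t : ℝ} (ht : 0 ≤ t) :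
    2 * t ≤ ‖s‖ * ‖1 + (t : ℂ) / s‖ ^ 2 := by
  have hs0 := ne_zero_of_re_pos hs
  have hn : 0 < ‖s‖ := norm_pos_iff.2 hs0
  have h1 : ‖s‖ * ‖1 + (t : ℂ) / s‖ = ‖s + t‖ := by
    rw [← norm_mul]; congr 1; field_simp
  have h2 : ‖s + t‖ ^ 2 = ‖s‖ ^ 2 + 2 * t * s.re + t ^ 2 := by
    rw [Complex.sq_norm, Complex.sq_norm, Complex.normSq_apply, Complex.normSq_apply]
    simp; ring
  -- The right side is `|s + t|²`. Dropping the nonnegative term `2 t Re s` leaves `|s|² + t² ≥ 2 t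
  -- |s|`.
  have h3 : ‖s‖ * (2 * t) ≤ ‖s‖ * (‖s‖ * ‖1 + (t : ℂ) / s‖ ^ 2) := by
    rw [← mul_assoc, show ‖s‖ * (‖s‖ * ‖1 + (t : ℂ) / s‖ ^ 2) = ‖s + t‖ ^ 2 by rw [← h1]; ring, h2]
    nlinarith [sq_nonneg (‖s‖ - t), mul_nonneg ht hs.le]
  exact le_of_mul_le_mul_left h3 hn

/-- `Re (s S / S^*) ≥ Re s`, where `S = 1 + d / s`. -/
theorem re_le_re_mul_stretch_div_conj {t : ℝ} (ht : 0 ≤ t) :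
    s.re ≤ (s * (1 + (t : ℂ) / s) / conj (1 + (t : ℂ) / s)).re := by
  have hs0 := ne_zero_of_re_pos hs
  have hc0 : conj s ≠ 0 := by simpa using hs0
  have hS0 := stretch_ne_zero hs ht
  have hst : s + t ≠ 0 := fun h => by
    have := congrArg Complex.re h
    simp at this; linarith
  have hst' : conj s + t ≠ 0 := fun h => hst (by
    have := congrArg conj h
    simpa using this)
  have hp : 0 < Complex.normSq (s + t) := Complex.normSq_pos.2 hst
  have h1 : s * (1 + (t : ℂ) / s) / conj (1 + (t : ℂ) / s) =
      ((s + t) ^ 2 * conj s) / (Complex.normSq (s + t) : ℂ) := by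
    rw [← Complex.mul_conj]
    simp only [map_add, map_one, map_div₀, Complex.conj_ofReal]
    have h2 : 1 + (t : ℂ) / s = (s + t) / s := by field_simp
    have h3 : 1 + (t : ℂ) / conj s = (conj s + t) / conj s := by field_simp
    rw [h2, h3]
    field_simp
  rw [h1, Complex.div_ofReal_re, le_div_iff₀ hp]
  rw [Complex.normSq_apply]
  simp only [Complex.add_re, Complex.add_im, Complex.ofReal_re, Complex.ofReal_im, Complex.mul_re,
    Complex.mul_im, pow_two, Complex.conj_re, Complex.conj_im, add_zero]
  -- The difference of the two sides is `2 t (Im s)²`.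
  nlinarith [mul_nonneg ht (sq_nonneg s.im), mul_nonneg ht hs.le]

/-- The first-order expansion of `1 / S^*` as a function of the damping. -/
theorem inv_conj_stretch_estimates {t₁ t₂ l : ℝ} (h₁ : 0 ≤ t₁) (h₂ : 0 ≤ t₂) :
    ‖1 / conj (1 + (t₁ : ℂ) / s) - 1 / conj (1 + (t₂ : ℂ) / s)‖ ≤ |t₁ - t₂| / ‖s‖ ∧
    ‖1 / conj (1 + (t₁ : ℂ) / s) - 1 / conj (1 + (t₂ : ℂ) / s) +
        l / conj s * (1 / conj (1 + (t₂ : ℂ) / s)) ^ 2‖ ≤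
      |t₁ - t₂ - l| / ‖s‖ + |l| * |t₁ - t₂| / ‖s‖ ^ 2 := by
  have hs0 := ne_zero_of_re_pos hs
  have hc0 : conj s ≠ 0 := by simpa using hs0
  have hA := stretch_ne_zero hs h₁
  have hB := stretch_ne_zero hs h₂
  have hA1 := one_le_norm_stretch hs h₁
  have hB1 := one_le_norm_stretch hs h₂
  set A := 1 + (t₁ : ℂ) / s with hAd
  set B := 1 + (t₂ : ℂ) / s with hBd
  have hA' : conj A ≠ 0 := by simpa using hA
  have hB' : conj B ≠ 0 := by simpa using hB
  have ha : ‖1 / conj A‖ ≤ 1 := by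
    rw [norm_div, norm_one, Complex.norm_conj]
    exact (div_le_one (by linarith)).2 hA1
  have hb : ‖1 / conj B‖ ≤ 1 := by
    rw [norm_div, norm_one, Complex.norm_conj]
    exact (div_le_one (by linarith)).2 hB1
  have hdiff : 1 / conj A - 1 / conj B =
      -(((t₁ - t₂ : ℝ) : ℂ) / conj s) * ((1 / conj A) * (1 / conj B)) := by
    have : conj B - conj A = -(((t₁ - t₂ : ℝ) : ℂ) / conj s) := by
      simp only [hAd, hBd, map_add, map_one, map_div₀, Complex.conj_ofReal]
      push_cast; ring
    rw [← this]; field_simp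
  have h1 : ‖1 / conj A - 1 / conj B‖ ≤ |t₁ - t₂| / ‖s‖ := by
    rw [hdiff, norm_mul, norm_mul, norm_neg, norm_div, Complex.norm_real, Complex.norm_conj,
      Real.norm_eq_abs]
    exact mul_le_of_le_one_right (by positivity) (mul_le_one₀ ha (norm_nonneg _) hb)
  refine ⟨h1, ?_⟩
  -- The remainder splits into the error of `l` as an approximation of `t₁ - t₂`, and `l` times the
  -- change of `1 / S^*` between the two points.
  have h2 : 1 / conj A - 1 / conj B + l / conj s * (1 / conj B) ^ 2 =
      -(((t₁ - t₂ - l : ℝ) : ℂ) / conj s) * ((1 / conj A) * (1 / conj B)) -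
        (l : ℂ) / conj s * (1 / conj B) * (1 / conj A - 1 / conj B) := by
    push_cast at hdiff ⊢; linear_combination hdiff
  rw [h2]
  refine (norm_sub_le _ _).trans (add_le_add ?_ ?_)
  · rw [norm_mul, norm_mul, norm_neg, norm_div, Complex.norm_real, Complex.norm_conj,
      Real.norm_eq_abs]
    exact mul_le_of_le_one_right (by positivity) (mul_le_one₀ ha (norm_nonneg _) hb)
  · rw [norm_mul, norm_mul, norm_div, Complex.norm_real, Complex.norm_conj, Real.norm_eq_abs]
    calc _ ≤ |l| / ‖s‖ * 1 * (|t₁ - t₂| / ‖s‖) := by gcongr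
      _ = _ := by ring

end Stretch

/-! ### First-order expansion of the multiplier. -/

/-- First-order expansion of a product of three numbers in the unit disc. -/
theorem norm_prod_sub_prod_le {a b : Fin 3 → ℂ} (ha : ∀ i, ‖a i‖ ≤ 1) (hb : ∀ i, ‖b i‖ ≤ 1)
    {r : ℝ} (hr : ∀ i, ‖a i - b i‖ ≤ r) :
    ‖∏ i, a i - ∏ i, b i‖ ≤ 3 * r ∧
    ∀ {ℓ : Fin 3 → ℂ} {ε : ℝ}, (∀ i, ‖a i - b i + ℓ i * b i‖ ≤ ε) →
      ‖∏ i, a i - ∏ i, b i - ∑ i, -(ℓ i * ∏ j, b j)‖ ≤ 3 * ε + 3 * r ^ 2 := by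
  have hr0 : 0 ≤ r := (norm_nonneg _).trans (hr 0)
  have mul1 : ∀ {x y : ℂ} {k : ℝ}, ‖x‖ ≤ k → ‖y‖ ≤ 1 → ‖x * y‖ ≤ k := fun hx hy => by
    rw [norm_mul]
    exact (mul_le_of_le_one_right (norm_nonneg _) hy).trans hx
  have mulr : ∀ {x y : ℂ}, ‖x‖ ≤ r → ‖y‖ ≤ r → ‖x * y‖ ≤ r ^ 2 := fun hx hy => by
    rw [norm_mul, pow_two]
    exact mul_le_mul hx hy (norm_nonneg _) hr0
  have e1 : ∏ i, a i - ∏ i, b i = (a 0 - b 0) * a 1 * a 2 + (a 1 - b 1) * b 0 * a 2 +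
      (a 2 - b 2) * b 0 * b 1 := by
    simp only [Fin.prod_univ_three]; ring
  refine ⟨?_, fun {ℓ ε} hε => ?_⟩
  · rw [e1]
    refine (norm_add₃_le ..).trans ?_
    have h0 := mul1 (mul1 (hr 0) (ha 1)) (ha 2)
    have h1 := mul1 (mul1 (hr 1) (hb 0)) (ha 2)
    have h2 := mul1 (mul1 (hr 2) (hb 0)) (hb 1)
    linarith
  -- In the telescoping sum, replacing the remaining `a i` by `b i` isolates the linear part. The
  -- correction consists of three products of two increments, each at most `r ^ 2`.
  · have e2 : ∏ i, a i - ∏ i, b i - ∑ i, -(ℓ i * ∏ j, b j) =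
        ((a 0 - b 0 + ℓ 0 * b 0) * b 1 * b 2 + (a 1 - b 1 + ℓ 1 * b 1) * b 0 * b 2 +
          (a 2 - b 2 + ℓ 2 * b 2) * b 0 * b 1) +
        ((a 0 - b 0) * (a 1 - b 1) * a 2 + (a 0 - b 0) * (a 2 - b 2) * b 1 +
          (a 1 - b 1) * (a 2 - b 2) * b 0) := by
      simp only [Fin.prod_univ_three, Fin.sum_univ_three]; ring
    rw [e2]
    have h0 := mul1 (mul1 (hε 0) (hb 1)) (hb 2)
    have h1 := mul1 (mul1 (hε 1) (hb 0)) (hb 2)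
    have h2 := mul1 (mul1 (hε 2) (hb 0)) (hb 1)
    have k0 := mul1 (mulr (hr 0) (hr 1)) (ha 2)
    have k1 := mul1 (mulr (hr 0) (hr 2)) (hb 1)
    have k2 := mul1 (mulr (hr 1) (hr 2)) (hb 0)
    refine (norm_add_le _ _).trans ?_
    have := norm_add₃_le (a := (a 0 - b 0 + ℓ 0 * b 0) * b 1 * b 2)
      (b := (a 1 - b 1 + ℓ 1 * b 1) * b 0 * b 2) (c := (a 2 - b 2 + ℓ 2 * b 2) * b 0 * b 1)
    have := norm_add₃_le (a := (a 0 - b 0) * (a 1 - b 1) * a 2)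
      (b := (a 0 - b 0) * (a 2 - b 2) * b 1) (c := (a 1 - b 1) * (a 2 - b 2) * b 0)
    linarith

/-- The multiplier `1 / (S_x S_y S_z)^*`. -/
noncomputable def multiplier (d : Fin 3 → ℝ → ℝ) (s : ℂ) (x : E3) : ℂ :=
  ∏ η, 1 / conj (stretch d s η x)

/-- The gradient of `multiplier`. -/
noncomputable def multiplierGrad (d : Fin 3 → ℝ → ℝ) (s : ℂ) (η : Fin 3) (x : E3) : ℂ :=
  -(((deriv (d η) (x η) : ℝ) : ℂ) / conj s * (1 / conj (stretch d s η x)) * multiplier d s x)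

theorem norm_one_div_conj_stretch_le {d : Fin 3 → ℝ → ℝ} {s : ℂ} (hs : 0 < s.re) {η : Fin 3}
    {x : E3} (hx : 0 ≤ d η (x η)) : ‖1 / conj (stretch d s η x)‖ ≤ 1 := by
  rw [norm_div, norm_one, Complex.norm_conj]
  exact div_le_one_of_le₀ (one_le_norm_stretch hs hx) (norm_nonneg _)

theorem norm_multiplier_le {d : Fin 3 → ℝ → ℝ} {s : ℂ} (hs : 0 < s.re)
    {x : E3} (hx : ∀ η, 0 ≤ d η (x η)) : ‖multiplier d s x‖ ≤ 1 := by
  rw [multiplier, norm_prod]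
  exact Finset.prod_le_one (fun _ _ => norm_nonneg _)
    fun η _ => norm_one_div_conj_stretch_le hs (hx η)

/-- Lipschitz estimate and first-order expansion for `multiplier`. -/
theorem multiplier_estimates {d : Fin 3 → ℝ → ℝ} {s : ℂ} (hs : 0 < s.re) {x y : E3}
    (hx : ∀ η, 0 ≤ d η (x η)) (hy : ∀ η, 0 ≤ d η (y η)) {Λ ω h : ℝ}
    (hh : dist x y ≤ h)
    (hΛ : ∀ η, |d η (x η) - d η (y η)| ≤ Λ * dist x y)
    (hΛ' : ∀ η, |deriv (d η) (y η)| ≤ Λ)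
    (hω : ∀ η, |d η (x η) - d η (y η) - deriv (d η) (y η) * (x η - y η)| ≤ ω * dist x y) :
    ‖multiplier d s x - multiplier d s y‖ ≤ 3 * Λ / ‖s‖ * dist x y ∧
    ‖multiplier d s x - multiplier d s y -
        ∑ η, multiplierGrad d s η y * ((x η : ℂ) - y η)‖ ≤
      (3 * ω / ‖s‖ + 6 * Λ ^ 2 * h / ‖s‖ ^ 2) * dist x y := by
  have hn : 0 < ‖s‖ := norm_pos_iff.2 (ne_zero_of_re_pos hs)
  have hΛ0 : 0 ≤ Λ := (abs_nonneg _).trans (hΛ' 0)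
  have hr : ∀ η, ‖1 / conj (stretch d s η x) - 1 / conj (stretch d s η y)‖ ≤
      Λ * dist x y / ‖s‖ := fun η =>
    (inv_conj_stretch_estimates (l := 0) hs (hx η) (hy η)).1.trans (by gcongr; exact hΛ η)
  have hε : ∀ η, ‖1 / conj (stretch d s η x) - 1 / conj (stretch d s η y) +
      ((deriv (d η) (y η) * (x η - y η) : ℝ) / conj s * (1 / conj (stretch d s η y))) *
        (1 / conj (stretch d s η y))‖ ≤
      ω * dist x y / ‖s‖ + Λ * dist x y * (Λ * dist x y) / ‖s‖ ^ 2 := fun η => by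
    have h1 := (inv_conj_stretch_estimates (l := deriv (d η) (y η) * (x η - y η)) hs
      (hx η) (hy η)).2
    rw [pow_two, ← mul_assoc] at h1
    refine h1.trans ?_
    have h2 : |deriv (d η) (y η) * (x η - y η)| ≤ Λ * dist x y := by
      rw [abs_mul]
      refine mul_le_mul (hΛ' η) ?_ (abs_nonneg _) hΛ0
      rw [dist_eq_norm]
      exact PiLp.norm_apply_le (x - y) η
    gcongr
    · exact hω η
    · exact hΛ η
  have key := norm_prod_sub_prod_le (fun η => norm_one_div_conj_stretch_le hs (hx η))
    (fun η => norm_one_div_conj_stretch_le hs (hy η)) hr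
  constructor
  · refine key.1.trans (le_of_eq ?_)
    ring
  · have k2 := key.2 hε
    have e : ∑ η, multiplierGrad d s η y * ((x η : ℂ) - y η) =
        ∑ η, -((((deriv (d η) (y η) * (x η - y η) : ℝ) : ℂ) / conj s *
          (1 / conj (stretch d s η y))) * ∏ ζ, 1 / conj (stretch d s ζ y)) := by
      refine Finset.sum_congr rfl fun η _ => ?_
      rw [multiplierGrad, multiplier]
      push_cast; ring
    rw [e]
    refine k2.trans ?_
    -- One distance of the quadratic remainder is traded for `h`, since the interpolation estimate
    -- wants a bound linear in the distance.
    have : Λ ^ 2 * (dist x y * dist x y) ≤ Λ ^ 2 * (h * dist x y) := by gcongr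
    calc _ = 3 * ω / ‖s‖ * dist x y + 6 / ‖s‖ ^ 2 * (Λ ^ 2 * (dist x y * dist x y)) := by
          field_simp; ring
      _ ≤ 3 * ω / ‖s‖ * dist x y + 6 / ‖s‖ ^ 2 * (Λ ^ 2 * (h * dist x y)) := by gcongr
      _ = _ := by ring

/-! ### Pointwise coercivity with the exact test function. -/

/-- Coercivity at a point: the test function `s u / (S_x S_y S_z)^*` in the weak form. -/
theorem re_weakForm_ge {s : ℂ} (hs : 0 < s.re) {κ ρ β : ℝ} (hκ : 0 < κ) (hρ : 0 < ρ)
    (hβ0 : 0 ≤ β) {t t' : Fin 3 → ℝ} (ht : ∀ η, 0 ≤ t η)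
    (hβ : ∀ η, √(κ / ρ) * |t' η| ≤ β * t η) {S : Fin 3 → ℂ}
    (hS : ∀ η, S η = 1 + (t η : ℂ) / s) (u : ℂ) (D : Fin 3 → ℂ) {g : ℂ} {G : Fin 3 → ℂ}
    (hg : g = ∏ η, 1 / conj (S η)) (hG : ∀ η, G η = -((t' η : ℂ) / conj s * (1 / conj (S η)) * g)) :
    (s.re - β / 2) * (1 / κ * ‖s * u‖ ^ 2 + ∑ η, 1 / ρ * ‖1 / S η * D η‖ ^ 2) ≤
      (conj (s ^ 2 * (∏ η, S η) / (κ : ℂ) * u) * (s * (g * u)) +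
        ∑ η, conj (1 / (ρ : ℂ) * (∏ ζ ∈ Finset.univ.erase η, S ζ) * (1 / S η * D η)) *
          (s * (g * D η + G η * u))).re := by
  have hs0 := ne_zero_of_re_pos hs
  have hn : 0 < ‖s‖ := norm_pos_iff.2 hs0
  have hc0 : conj s ≠ 0 := by simpa using hs0
  have hS0 : ∀ η, S η ≠ 0 := fun η => hS η ▸ stretch_ne_zero hs (ht η)
  have hcS0 : ∀ η, conj (S η) ≠ 0 := fun η => by simpa using hS0 η
  have hgP : conj (∏ η, S η) * g = 1 := by
    rw [hg, map_prod, ← Finset.prod_mul_distrib]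
    exact Finset.prod_eq_one fun η _ => by rw [mul_one_div, div_self (hcS0 η)]
  -- The multiplier cancels the two stretching factors in `𝐒` and leaves the third as `1 / S_η^*`,
  -- which turns the stiffness term into a square.
  have hgE : ∀ η, conj (∏ ζ ∈ Finset.univ.erase η, S ζ) * g = 1 / conj (S η) := fun η => by
    rw [eq_div_iff (hcS0 η), ← hgP, ← Finset.mul_prod_erase Finset.univ S (Finset.mem_univ η),
      map_mul]
    ring
  have e0 : conj (s ^ 2 * (∏ η, S η) / (κ : ℂ) * u) * (s * (g * u)) =
      conj s * ((1 / κ * ‖s * u‖ ^ 2 : ℝ) : ℂ) := by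
    have : ((‖s * u‖ ^ 2 : ℝ) : ℂ) = s * u * conj (s * u) := by
      rw [Complex.mul_conj, Complex.normSq_eq_norm_sq]
    push_cast at this ⊢
    rw [this]
    simp only [map_mul, map_div₀, map_pow, Complex.conj_ofReal]
    calc _ = (conj (∏ η, S η) * g) * (conj s * (1 / (κ : ℂ) * (s * u * (conj s * conj u)))) := by
          ring
      _ = _ := by rw [hgP, one_mul]
  have e1 : ∀ η, conj (1 / (ρ : ℂ) * (∏ ζ ∈ Finset.univ.erase η, S ζ) * (1 / S η * D η)) *
      (s * (g * D η + G η * u)) =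
      s * S η / conj (S η) * ((1 / ρ * ‖1 / S η * D η‖ ^ 2 : ℝ) : ℂ) +
        -(1 / (ρ : ℂ) * conj (1 / S η * D η) * (s * u) *
          ((t' η : ℂ) / (conj s * conj (S η) ^ 2))) := fun η => by
    have : ((‖1 / S η * D η‖ ^ 2 : ℝ) : ℂ) = 1 / S η * D η * conj (1 / S η * D η) := by
      rw [Complex.mul_conj, Complex.normSq_eq_norm_sq]
    push_cast at this ⊢
    rw [this, hG, map_mul, map_mul (starRingEnd ℂ) (1 / (ρ : ℂ)), map_div₀ (starRingEnd ℂ) 1,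
      map_one, Complex.conj_ofReal]
    have hSe := hS0 η
    have hcSe := hcS0 η
    set Y := conj (1 / S η * D η)
    calc _ = (conj (∏ ζ ∈ Finset.univ.erase η, S ζ) * g) * (1 / (ρ : ℂ) * Y *
          (s * (D η + -((t' η : ℂ) / conj s * (1 / conj (S η))) * u))) := by ring
      _ = _ := by rw [hgE]; field_simp
  rw [e0, Finset.sum_congr rfl fun η _ => e1 η, Complex.add_re, Complex.re_sum]
  have r0 : (conj s * ((1 / κ * ‖s * u‖ ^ 2 : ℝ) : ℂ)).re = s.re * (1 / κ * ‖s * u‖ ^ 2) := by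
    rw [Complex.re_mul_ofReal, Complex.conj_re]
  -- The cross term is split by `X Y ≤ X² / 4 + Y²`. The mass part is charged once for each of the
  -- three directions, in total `3 / 4`, which is below one.
  have r1 : ∀ η, s.re * (1 / ρ * ‖1 / S η * D η‖ ^ 2) -
      β / 2 * (1 / 4 * (1 / κ * ‖s * u‖ ^ 2) + 1 / ρ * ‖1 / S η * D η‖ ^ 2) ≤
      (s * S η / conj (S η) * ((1 / ρ * ‖1 / S η * D η‖ ^ 2 : ℝ) : ℂ) +
        -(1 / (ρ : ℂ) * conj (1 / S η * D η) * (s * u) *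
          ((t' η : ℂ) / (conj s * conj (S η) ^ 2)))).re := fun η => by
    rw [Complex.add_re, Complex.re_mul_ofReal]
    have h1 : s.re ≤ (s * S η / conj (S η)).re := by
      rw [hS]; exact re_le_re_mul_stretch_div_conj hs (ht η)
    have h2 : s.re * (1 / ρ * ‖1 / S η * D η‖ ^ 2) ≤
        (s * S η / conj (S η)).re * (1 / ρ * ‖1 / S η * D η‖ ^ 2) := by gcongr
    have h3 : ‖-(1 / (ρ : ℂ) * conj (1 / S η * D η) * (s * u) *
        ((t' η : ℂ) / (conj s * conj (S η) ^ 2)))‖ ≤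
        β / 2 * (1 / 4 * (1 / κ * ‖s * u‖ ^ 2) + 1 / ρ * ‖1 / S η * D η‖ ^ 2) := by
      have hnorm : ∀ Y X : ℂ, ‖-(1 / (ρ : ℂ) * conj Y * X *
          ((t' η : ℂ) / (conj s * conj (S η) ^ 2)))‖ =
          1 / ρ * ‖Y‖ * ‖X‖ * (|t' η| / (‖s‖ * ‖S η‖ ^ 2)) := fun Y X => by
        simp [abs_of_pos hρ]
      rw [hnorm]
      set X := ‖s * u‖
      set Y := ‖1 / S η * D η‖
      have hq := two_mul_le_norm_mul_norm_stretch_sq hs (ht η)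
      rw [← hS η] at hq
      set q := ‖s‖ * ‖S η‖ ^ 2
      have hqp : 0 < q := mul_pos hn (pow_pos (norm_pos_iff.2 (hS0 η)) 2)
      -- The factor `1 / 2` comes from `2 d ≤ |s| |S|²`. It leaves the room in which interpolation
      -- errors are later absorbed.
      have h4 : √(κ / ρ) * (|t' η| / q) ≤ β / 2 := by
        rw [← mul_div_assoc, div_le_iff₀ hqp]
        nlinarith [hβ η]
      have hk : 0 < √κ := Real.sqrt_pos.2 hκ
      have hr : 0 < √ρ := Real.sqrt_pos.2 hρ
      have h5 : 1 / ρ * Y * X * (|t' η| / q) =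
          (√(κ / ρ) * (|t' η| / q)) * ((X / √κ) * (Y / √ρ)) := by
        rw [Real.sqrt_div hκ.le]
        have := Real.mul_self_sqrt hρ.le
        have hρ' : ρ = √ρ * √ρ := this.symm
        conv_lhs => rw [hρ']
        field_simp
      rw [h5]
      have h6 : 1 / κ * X ^ 2 = (X / √κ) ^ 2 := by rw [div_pow, Real.sq_sqrt hκ.le]; ring
      have h7 : 1 / ρ * Y ^ 2 = (Y / √ρ) ^ 2 := by rw [div_pow, Real.sq_sqrt hρ.le]; ring
      rw [h6, h7]
      have h8 : 0 ≤ (X / √κ) * (Y / √ρ) := by positivity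
      refine mul_le_mul h4 ?_ h8 (by positivity)
      nlinarith [sq_nonneg (1 / 2 * (X / √κ) - Y / √ρ)]
    have h4 := (abs_le.1 (Complex.abs_re_le_norm (-(1 / (ρ : ℂ) * conj (1 / S η * D η) * (s * u) *
        ((t' η : ℂ) / (conj s * conj (S η) ^ 2)))))).1
    linarith
  rw [r0]
  have r2 := Finset.sum_le_sum fun η (_ : η ∈ Finset.univ) => r1 η
  refine le_trans ?_ (add_le_add_right r2 _)
  simp only [Fin.sum_univ_three]
  have : 0 ≤ 1 / κ * ‖s * u‖ ^ 2 := by positivity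
  nlinarith [mul_nonneg hβ0 this]

/-- The weighted Cauchy-Schwarz inequality for double sums. -/
theorem sum_sum_mul_le_sqrt_mul_sqrt {ι : Type*} [Fintype ι] {n : ι → ℕ}
    {w f g : ∀ K, Fin (n K) → ℝ} (hw : ∀ K i, 0 ≤ w K i) :
    ∑ K, ∑ i, w K i * (f K i * g K i) ≤
      √(∑ K, ∑ i, w K i * f K i ^ 2) * √(∑ K, ∑ i, w K i * g K i ^ 2) := by
  simp only [Finset.sum_sigma']
  have h := Real.sum_mul_le_sqrt_mul_sqrt
    (Finset.univ.sigma fun K : ι => (Finset.univ : Finset (Fin (n K))))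
    (fun a => √(w a.1 a.2) * f a.1 a.2) (fun a => √(w a.1 a.2) * g a.1 a.2)
  convert h using 1
  · refine Finset.sum_congr rfl fun a _ => ?_
    rw [mul_mul_mul_comm, Real.mul_self_sqrt (hw _ _)]
  · congr 2 <;>
    · refine Finset.sum_congr rfl fun a _ => ?_
      rw [mul_pow, Real.sq_sqrt (hw _ _)]

/-! ### Interpolation errors in terms of the energy on one element. -/

namespace LagrangeElement

variable {p : ℕ} {e : LagrangeElement p}

/-- On one element: the interpolant of `g u`, where `g` is the multiplier, has errors that are
controlled by the energy `N²` of `u` on the element. -/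
theorem exists_testFunction (hp : 1 ≤ p) {q : Quadrature e} {c σ h b B : ℝ} (hc : RefBound e q c)
    (hσ : 0 ≤ σ) {A : E3 ≃ᵃ[ℝ] E3} (hdist : ∀ x ∈ e.mapCell A, ∀ y ∈ e.mapCell A, dist x y ≤ h)
    (hA : ∀ η, h * ‖A.symm.linear (EuclideanSpace.single η 1)‖ ≤ c * σ) (h0 : 0 ≤ h)
    {u : MvPolynomial (Fin 3) ℂ} (hu : u ∈ e.mapSpace A) {g : E3 → ℂ} {G : Fin 3 → E3 → ℂ}
    {t₁ t₂ : ℝ} (ht₁ : 0 ≤ t₁) (ht₂ : 0 ≤ t₂)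
    (hg : ∀ x ∈ e.mapCell A, ∀ y ∈ e.mapCell A, ‖g x - g y‖ ≤ t₁ * dist x y)
    (hG : ∀ x ∈ e.mapCell A, ∀ y ∈ e.mapCell A,
      ‖g x - g y - ∑ η, G η y * ((x η : ℂ) - y η)‖ ≤ t₂ * dist x y)
    (hb : 1 ≤ b) (hB : 1 ≤ B) {s : ℂ} {κ ρ : Fin q.m → ℝ} {S : Fin q.m → Fin 3 → ℂ}
    (hκ : ∀ i, 1 ≤ b * (1 / κ i)) (hρ : ∀ i, 1 ≤ b * (1 / ρ i))
    (hS : ∀ i η, ‖S i η‖ ≤ B) (hS0 : ∀ i η, S i η ≠ 0) {N : ℝ} (hN0 : 0 ≤ N)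
    (hN : N ^ 2 = ∑ i, q.weight i * (1 / κ i * ‖s * evalAt u (A (q.point i))‖ ^ 2 +
      ∑ η, 1 / ρ i * ‖1 / S i η * evalAt (pderiv η u) (A (q.point i))‖ ^ 2)) :
    ∃ v ∈ e.mapSpace A,
      (∀ j, evalAt v (e.mapNode A j) = g (e.mapNode A j) * evalAt u (e.mapNode A j)) ∧
      ∀ i, ‖s * evalAt u (A (q.point i))‖ ≤ b * c * N ∧
        (∀ η, ‖1 / S i η * evalAt (pderiv η u) (A (q.point i))‖ ≤ b * c * N) ∧
        ‖s * (evalAt v (A (q.point i)) - g (A (q.point i)) * evalAt u (A (q.point i)))‖ ≤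
          9 * b * c ^ 6 * (σ + 1) * (h * (t₁ + t₂)) * N ∧
        ∀ η, ‖s * (evalAt (pderiv η v) (A (q.point i)) -
            (g (A (q.point i)) * evalAt (pderiv η u) (A (q.point i)) +
              G η (A (q.point i)) * evalAt u (A (q.point i))))‖ ≤
          27 * b * c ^ 6 * (σ + 1) * B * (‖s‖ * h * t₁ + t₂) * N := by
  obtain ⟨v, hv, hvn, hve⟩ := exists_interpolant hp hc hσ hdist hA h0 hu ht₁ ht₂ hg hG
  refine ⟨v, hv, hvn, ?_⟩
  have hc1 := hc.one_le
  have hc0 : 0 < c := by linarith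
  have hκ0 : ∀ i, 0 ≤ 1 / κ i := fun i => by
    by_contra hneg
    nlinarith [hκ i]
  have hρ0 : ∀ i, 0 ≤ 1 / ρ i := fun i => by
    by_contra hneg
    nlinarith [hρ i]
  have hw : ∀ i, 0 ≤ q.weight i := fun i => (q.weight_pos i).le
  set E : Fin q.m → ℝ := fun i => 1 / κ i * ‖s * evalAt u (A (q.point i))‖ ^ 2 +
      ∑ η, 1 / ρ i * ‖1 / S i η * evalAt (pderiv η u) (A (q.point i))‖ ^ 2 with hE
  have hs0 : ∀ i, 0 ≤ ∑ η, 1 / ρ i * ‖1 / S i η * evalAt (pderiv η u) (A (q.point i))‖ ^ 2 :=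
    fun i => Finset.sum_nonneg fun η _ => mul_nonneg (hρ0 i) (sq_nonneg _)
  have hE0 : ∀ i, 0 ≤ E i := fun i =>
    add_nonneg (mul_nonneg (hκ0 i) (sq_nonneg _)) (hs0 i)
  -- Positive weights, bounded below by `1 / c`, make the element energy control the density at
  -- every single quadrature point.
  have hEN : ∀ i, E i ≤ c * N ^ 2 := fun i => by
    have h1 : q.weight i * E i ≤ N ^ 2 := hN ▸
      Finset.single_le_sum (f := fun i => q.weight i * E i)
        (fun i _ => mul_nonneg (hw i) (hE0 i)) (Finset.mem_univ i)
    have h2 := mul_le_mul_of_nonneg_right (hc.one_le_weight i) (hE0 i)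
    nlinarith
  have hsq : ∀ (i) {a k : ℝ}, 0 ≤ a → 1 ≤ b * k → k * a ^ 2 ≤ E i → a ≤ b * c * N := by
    intro i a k ha hk hak
    have h1 : a ^ 2 ≤ b * (k * a ^ 2) := by nlinarith [sq_nonneg a]
    have h2 : a ^ 2 ≤ (b * c) * N ^ 2 := by nlinarith [hEN i]
    have h3 : 1 ≤ b * c := by nlinarith
    refine (sq_le_sq₀ ha (by positivity)).1 (h2.trans ?_)
    rw [mul_pow]
    exact mul_le_mul_of_nonneg_right (by nlinarith) (sq_nonneg _)
  have hX : ∀ i, ‖s * evalAt u (A (q.point i))‖ ≤ b * c * N := fun i =>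
    hsq i (norm_nonneg _) (hκ i) (le_add_of_nonneg_right (hs0 i))
  have hY : ∀ i η, ‖1 / S i η * evalAt (pderiv η u) (A (q.point i))‖ ≤ b * c * N := fun i η =>
    hsq i (norm_nonneg _) (hρ i) ((Finset.single_le_sum
      (f := fun η => 1 / ρ i * ‖1 / S i η * evalAt (pderiv η u) (A (q.point i))‖ ^ 2)
      (fun η _ => mul_nonneg (hρ0 i) (sq_nonneg _)) (Finset.mem_univ η)).trans
      (le_add_of_nonneg_left (mul_nonneg (hκ0 i) (sq_nonneg _))))
  have hsumm : ∀ k : ℝ, 0 ≤ k → ∑ _i : Fin q.m, k ≤ c * k := fun k hk => by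
    simpa using mul_le_mul_of_nonneg_right hc.m_le hk
  have hU : ‖s‖ * ∑ i, ‖evalAt u (A (q.point i))‖ ≤ b * c ^ 2 * N := by
    rw [Finset.mul_sum]
    calc _ ≤ ∑ _i : Fin q.m, b * c * N := Finset.sum_le_sum fun i _ => by
          rw [← norm_mul]; exact hX i
      _ ≤ c * (b * c * N) := hsumm _ (by positivity)
      _ = _ := by ring
  -- The energy contains `S⁻¹ ∂u`, not `∂u`; passing between them costs the upper bound `B` of
  -- `|S|`.
  have hW : ∑ i, ∑ ζ, ‖evalAt (pderiv ζ u) (A (q.point i))‖ ≤ 3 * B * b * c ^ 2 * N := by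
    have h1 : ∀ i ζ, ‖evalAt (pderiv ζ u) (A (q.point i))‖ ≤ B * (b * c * N) := fun i ζ => by
      calc _ = ‖S i ζ‖ * ‖1 / S i ζ * evalAt (pderiv ζ u) (A (q.point i))‖ := by
            rw [← norm_mul, ← mul_assoc, mul_one_div, div_self (hS0 i ζ), one_mul]
        _ ≤ _ := mul_le_mul (hS i ζ) (hY i ζ) (norm_nonneg _) (by linarith)
    calc _ ≤ ∑ _i : Fin q.m, 3 * (B * (b * c * N)) := Finset.sum_le_sum fun i _ => by
          rw [Fin.sum_univ_three]; linarith [h1 i 0, h1 i 1, h1 i 2]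
      _ ≤ c * (3 * (B * (b * c * N))) := hsumm _ (by positivity)
      _ = _ := by ring
  intro i
  obtain ⟨e1, e2⟩ := hve (A (q.point i)) ⟨_, q.point_mem i, rfl⟩
  refine ⟨hX i, hY i, ?_, fun η => ?_⟩
  · rw [norm_mul]
    calc _ ≤ ‖s‖ * (9 * c ^ 4 * (σ + 1) * (h * (t₁ + t₂)) *
          ∑ i, ‖evalAt u (A (q.point i))‖) := mul_le_mul_of_nonneg_left e1 (norm_nonneg _)
      _ = 9 * c ^ 4 * (σ + 1) * (h * (t₁ + t₂)) *
          (‖s‖ * ∑ i, ‖evalAt u (A (q.point i))‖) := by ring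
      _ ≤ 9 * c ^ 4 * (σ + 1) * (h * (t₁ + t₂)) * (b * c ^ 2 * N) :=
        mul_le_mul_of_nonneg_left hU (by positivity)
      _ = _ := by ring
  · rw [norm_mul]
    calc _ ≤ ‖s‖ * _ := mul_le_mul_of_nonneg_left (e2 η) (norm_nonneg _)
      _ = 9 * c ^ 4 * (σ + 1) *
          (‖s‖ * h * t₁ * (∑ i, ∑ ζ, ‖evalAt (pderiv ζ u) (A (q.point i))‖) +
          t₂ * (‖s‖ * ∑ i, ‖evalAt u (A (q.point i))‖)) := by ring
      _ ≤ 9 * c ^ 4 * (σ + 1) *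
          (‖s‖ * h * t₁ * (3 * B * b * c ^ 2 * N) + t₂ * (b * c ^ 2 * N)) := by gcongr
      _ = 9 * c ^ 4 * (σ + 1) * (b * c ^ 2 * N) * (3 * B * (‖s‖ * h * t₁) + 1 * t₂) := by ring
      _ ≤ 9 * c ^ 4 * (σ + 1) * (b * c ^ 2 * N) * (3 * B * (‖s‖ * h * t₁) + 3 * B * t₂) := by
        gcongr
        linarith
      _ = _ := by ring

end LagrangeElement

/-- The error at a point, when the test function is replaced by an interpolant. -/
theorem norm_weakForm_error_le {s : ℂ} {κ ρ b c B N k h t₁ t₂ : ℝ}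
    (hκ : 0 < κ) (hρ : 0 < ρ) (hκb : 1 / κ ≤ b) (hρb : 1 / ρ ≤ b) (hB : 1 ≤ B)
    (hc : 0 ≤ c) (hN : 0 ≤ N) (hk : 0 ≤ k) (hh : 0 ≤ h) (ht₂ : 0 ≤ t₂)
    {S D ε : Fin 3 → ℂ} {u ε₀ : ℂ} (hS : ∀ η, ‖S η‖ ≤ B)
    (hu : ‖s * u‖ ≤ b * c * N) (hD : ∀ η, ‖1 / S η * D η‖ ≤ b * c * N)
    (hε₀ : ‖s * ε₀‖ ≤ k * (h * (t₁ + t₂)) * N)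
    (hε : ∀ η, ‖s * ε η‖ ≤ 3 * k * B * (‖s‖ * h * t₁ + t₂) * N) :
    ‖conj (s ^ 2 * (∏ η, S η) / (κ : ℂ) * u) * (s * ε₀) +
        ∑ η, conj (1 / (ρ : ℂ) * (∏ ζ ∈ Finset.univ.erase η, S ζ) * (1 / S η * D η)) *
          (s * ε η)‖ ≤
      10 * k * b ^ 2 * c * B ^ 3 * (‖s‖ * h * (t₁ + t₂) + t₂) * N ^ 2 := by
  have hb : 0 ≤ b := (by positivity : 0 ≤ 1 / κ).trans hκb
  have hB0 : 0 ≤ B := by linarith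
  have hprod : ∀ F : Finset (Fin 3), ‖∏ η ∈ F, S η‖ ≤ B ^ F.card := fun F => by
    rw [norm_prod]
    exact (Finset.prod_le_prod (fun _ _ => norm_nonneg _) fun η _ => hS η).trans_eq
      (Finset.prod_const _)
  have h1 : ‖conj (s ^ 2 * (∏ η, S η) / (κ : ℂ) * u) * (s * ε₀)‖ ≤
      k * b ^ 2 * c * B ^ 3 * (‖s‖ * h * (t₁ + t₂)) * N ^ 2 := by
    have e : ‖conj (s ^ 2 * (∏ η, S η) / (κ : ℂ) * u) * (s * ε₀)‖ =
        ‖s‖ * ‖∏ η, S η‖ * (1 / κ) * ‖s * u‖ * ‖s * ε₀‖ := by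
      simp only [norm_mul, Complex.norm_conj, norm_div, norm_pow, Complex.norm_real,
        Real.norm_of_nonneg hκ.le]
      ring
    rw [e]
    have h3 := hprod Finset.univ
    simp only [Finset.card_univ, Fintype.card_fin] at h3
    calc _ ≤ ‖s‖ * B ^ 3 * b * (b * c * N) * (k * (h * (t₁ + t₂)) * N) := by gcongr
      _ = _ := by ring
  have h2 : ∀ η, ‖conj (1 / (ρ : ℂ) * (∏ ζ ∈ Finset.univ.erase η, S ζ) * (1 / S η * D η)) *
      (s * ε η)‖ ≤ 3 * k * b ^ 2 * c * B ^ 3 * (‖s‖ * h * (t₁ + t₂) + t₂) * N ^ 2 := fun η => by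
    have e : ‖conj (1 / (ρ : ℂ) * (∏ ζ ∈ Finset.univ.erase η, S ζ) * (1 / S η * D η)) *
        (s * ε η)‖ =
        1 / ρ * ‖∏ ζ ∈ Finset.univ.erase η, S ζ‖ * ‖1 / S η * D η‖ * ‖s * ε η‖ := by
      rw [norm_mul, Complex.norm_conj, norm_mul, norm_mul, norm_div, norm_one, Complex.norm_real,
        Real.norm_of_nonneg hρ.le]
    rw [e]
    have h3 := hprod (Finset.univ.erase η)
    simp only [Finset.card_erase_of_mem (Finset.mem_univ η), Finset.card_univ,
      Fintype.card_fin] at h3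
    have h4 : ‖s‖ * h * t₁ + t₂ ≤ ‖s‖ * h * (t₁ + t₂) + t₂ := by
      have : 0 ≤ ‖s‖ * h * t₂ := by positivity
      linarith
    calc _ ≤ b * B ^ (3 - 1) * (b * c * N) * (3 * k * B * (‖s‖ * h * t₁ + t₂) * N) := by
          gcongr
          exact hD η
          exact hε η
      _ ≤ b * B ^ (3 - 1) * (b * c * N) * (3 * k * B * (‖s‖ * h * (t₁ + t₂) + t₂) * N) := by
          gcongr
      _ = _ := by norm_num; ring
  refine (norm_add_le _ _).trans ((add_le_add h1 (norm_sum_le_of_le _ fun η _ => h2 η)).trans ?_)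
  -- The factor 10 is one from the mass term and three from each of the three directions.
  rw [Finset.sum_const, Finset.card_univ, Fintype.card_fin, nsmul_eq_mul]
  have : 0 ≤ k * b ^ 2 * c * B ^ 3 * t₂ * N ^ 2 := by positivity
  push_cast
  linarith

/-! ### Assembly over the mesh and the energy inequality. -/

namespace Mesh

variable {Ω : Set E3} {p : ℕ} {R : Type} {el : R → LagrangeElement p} (T : Mesh Ω el)

theorem cell_subset (K : T.ι) : T.cell K ⊆ closure Ω := by
  rw [← T.cover]
  exact Set.subset_iUnion (fun K => (el (T.ref K)).mapCell (T.map K)) K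

theorem dist_le_diam {K : T.ι} {x y : E3} (hx : x ∈ T.cell K) (hy : y ∈ T.cell K) :
    dist x y ≤ Metric.diam (T.cell K) :=
  Metric.dist_le_diam_of_mem (LagrangeElement.isCompact_mapCell _).isBounded hx hy

theorem diam_le_size (K : T.ι) : Metric.diam (T.cell K) ≤ T.size :=
  le_ciSup (f := fun K => Metric.diam (T.cell K)) (Set.finite_range _).bddAbove K

theorem size_nonneg : 0 ≤ T.size := Real.iSup_nonneg fun _ => Metric.diam_nonneg

theorem qpoint_mem (q : ∀ r, Quadrature (el r)) (K : T.ι) (i : Fin (q (T.ref K)).m) :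
    T.qpoint q K i ∈ T.cell K := ⟨_, (q (T.ref K)).point_mem i, rfl⟩

variable {T} in
/-- The nodal interpolant of a multiple of a function in `V_h` is in `V_h`. -/
theorem mem_Vh_of_node_eq {u v : T.ι → MvPolynomial (Fin 3) ℂ} (hu : u ∈ T.Vh) (g : E3 → ℂ)
    (hv : ∀ K, v K ∈ T.space K)
    (hn : ∀ K j, evalAt (v K) ((el (T.ref K)).mapNode (T.map K) j) =
      g ((el (T.ref K)).mapNode (T.map K) j) *
        evalAt (u K) ((el (T.ref K)).mapNode (T.map K) j)) : v ∈ T.Vh := by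
  -- At a shared node `u` has one value and so does `g`, hence the nodal values of `v` match. The
  -- trace conditions extend this from nodes to whole faces and to the boundary.
  refine ⟨hv, fun K L => T.trace_match K L _ (hv K) _ (hv L) fun i hi => ?_,
    fun K => T.trace_boundary K _ (hv K) fun i hi => ?_⟩
  · obtain ⟨j, hj⟩ := T.node_match K L i hi
    rw [hn K i, ← hj, hn L j, hj,
      hu.2.1 K L _ ⟨LagrangeElement.mapNode_mem (T.map K) i, hi⟩]
  · rw [hn K i, hu.2.2 K _ ⟨LagrangeElement.mapNode_mem (T.map K) i, hi⟩, mul_zero]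

end Mesh

namespace Mesh

variable {Ω : Set E3} {p : ℕ} {R : Type} {el : R → LagrangeElement p} {T : Mesh Ω el}
  {q : ∀ r, Quadrature (el r)} {M : Medium Ω}

theorem qweight_nonneg (K : T.ι) (i : Fin (q (T.ref K)).m) : 0 ≤ T.qweight q K i :=
  mul_nonneg (abs_nonneg _) ((q (T.ref K)).weight_pos i).le

theorem Sampling.kappa_pos (m : T.Sampling q M) (K : T.ι) (i : Fin (q (T.ref K)).m) :
    0 < m.kappa K i := M.kappa_pos _ _ (m.mem K i)

theorem Sampling.rho_pos (m : T.Sampling q M) (K : T.ι) (i : Fin (q (T.ref K)).m) :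
    0 < m.rho K i := M.rho_pos _ _ (m.mem K i)

/-- The energy density of a discrete function at a quadrature point. -/
noncomputable def energyDensity (m : T.Sampling q M) (d : Fin 3 → ℝ → ℝ) (s : ℂ)
    (u : T.ι → MvPolynomial (Fin 3) ℂ) : T.GridFun q ℝ := fun K i =>
  1 / m.kappa K i * ‖s * T.val q u K i‖ ^ 2 +
    ∑ η, 1 / m.rho K i * ‖1 / T.sval q d s η K i * T.dval q η u K i‖ ^ 2

theorem energyDensity_nonneg (m : T.Sampling q M) (d : Fin 3 → ℝ → ℝ) (s : ℂ)
    (u : T.ι → MvPolynomial (Fin 3) ℂ) (K : T.ι) (i : Fin (q (T.ref K)).m) :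
    0 ≤ energyDensity m d s u K i := by
  have h1 := m.kappa_pos K i
  have h2 := m.rho_pos K i
  unfold energyDensity
  positivity

theorem solutionEnergy_sq (m : T.Sampling q M) (d : Fin 3 → ℝ → ℝ) (s : ℂ)
    (u : T.ι → MvPolynomial (Fin 3) ℂ) :
    solutionEnergy m d s u ^ 2 = ∑ K, ∑ i, T.qweight q K i * energyDensity m d s u K i := by
  have h : T.hNormSq q (fun K i => 1 / m.kappa K i) (fun K i => s * T.val q u K i) +
      ∑ η, T.hNormSq q (fun K i => 1 / m.rho K i)
        (fun K i => 1 / T.sval q d s η K i * T.dval q η u K i) =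
      ∑ K, ∑ i, T.qweight q K i * energyDensity m d s u K i := by
    unfold hNormSq energyDensity
    rw [Finset.sum_comm, ← Finset.sum_add_distrib]
    refine Finset.sum_congr rfl fun K _ => ?_
    rw [Finset.sum_comm, ← Finset.sum_add_distrib]
    refine Finset.sum_congr rfl fun i _ => ?_
    rw [mul_add, Finset.mul_sum]
  rw [solutionEnergy, h, Real.sq_sqrt]
  exact Finset.sum_nonneg fun K _ => Finset.sum_nonneg fun i _ =>
    mul_nonneg (qweight_nonneg K i) (energyDensity_nonneg m d s u K i)

/-- The energy inequality, up to interpolation errors. -/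
theorem energy_inequality (hp : 1 ≤ p) {c σ h b B : ℝ} (hσ : 0 < σ)
    (hc1 : 1 ≤ c) (hc : ∀ r, RefBound (el r) (q r) c)
    (hreg : T.ShapeRegular σ) (m : T.Sampling q M) {d : Fin 3 → ℝ → ℝ}
    (hd0 : ∀ x ∈ closure Ω, ∀ η, 0 ≤ d η (x η))
    {β : ℝ} (hβ0 : 0 ≤ β) (hβ : ∀ j, ∀ x ∈ closure (M.sub j), ∀ η,
      √(M.kappa j x / M.rho j x) * |deriv (d η) (x η)| ≤ β * d η (x η))
    (hb : 1 ≤ b) (hB : 1 ≤ B)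
    (hM : ∀ j, ∀ x ∈ closure (M.sub j), 1 / b ≤ M.kappa j x ∧ M.kappa j x ≤ b ∧
      1 / b ≤ M.rho j x ∧ M.rho j x ≤ b)
    {s : ℂ} (hs : 0 < s.re) (hS : ∀ x ∈ closure Ω, ∀ η, ‖stretch d s η x‖ ≤ B)
    (hh : T.size ≤ h) {t₁ t₂ : ℝ} (ht₁ : 0 ≤ t₁) (ht₂ : 0 ≤ t₂)
    (hg : ∀ K, ∀ x ∈ T.cell K, ∀ y ∈ T.cell K,
      ‖multiplier d s x - multiplier d s y‖ ≤ t₁ * dist x y)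
    (hG : ∀ K, ∀ x ∈ T.cell K, ∀ y ∈ T.cell K,
      ‖multiplier d s x - multiplier d s y -
        ∑ η, multiplierGrad d s η y * ((x η : ℂ) - y η)‖ ≤ t₂ * dist x y)
    (F : T.GridFun q ℂ) {u : T.ι → MvPolynomial (Fin 3) ℂ} (hu : u ∈ T.Vh)
    (hweak : ReducedWeakForm m d s F u) :
    (s.re - β / 2 - 90 * b ^ 3 * c ^ 9 * (σ + 1) * B ^ 3 * (‖s‖ * h * (t₁ + t₂) + t₂)) *
        solutionEnergy m d s u ^ 2 ≤
      (1 + 9 * b ^ 2 * c ^ 7 * (σ + 1) * (h * (t₁ + t₂))) *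
        (solutionEnergy m d s u * dataEnergy m F) := by
  classical
  have hc0 : 0 ≤ c := by linarith
  have hh0 : 0 ≤ h := T.size_nonneg.trans hh
  have hq : ∀ K i, T.qpoint q K i ∈ closure Ω := fun K i => T.cell_subset K (T.qpoint_mem q K i)
  have hqd : ∀ K i η, 0 ≤ d η (T.qpoint q K i η) := fun K i η => hd0 _ (hq K i) η
  set detK : T.ι → ℝ := fun K => |LinearMap.det ((T.map K).linear : E3 →ₗ[ℝ] E3)| with hdet
  have hdet0 : ∀ K, 0 ≤ detK K := fun K => abs_nonneg _
  set En := energyDensity m d s u with hEn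
  have hEn0 : ∀ K i, 0 ≤ En K i := energyDensity_nonneg m d s u
  have hw0 : ∀ K i, 0 ≤ (q (T.ref K)).weight i := fun K i => ((q (T.ref K)).weight_pos i).le
  -- The element energy is taken with reference weights, as in the reference estimates. The
  -- Jacobian, constant on an element, only enters in the sum over elements.
  set N : T.ι → ℝ := fun K => √(∑ i, (q (T.ref K)).weight i * En K i) with hNdef
  have hN0 : ∀ K, 0 ≤ N K := fun K => Real.sqrt_nonneg _
  have hN : ∀ K, N K ^ 2 = ∑ i, (q (T.ref K)).weight i * En K i := fun K =>
    Real.sq_sqrt (Finset.sum_nonneg fun i _ => mul_nonneg (hw0 K i) (hEn0 K i))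
  have hE : solutionEnergy m d s u ^ 2 = ∑ K, detK K * N K ^ 2 := by
    rw [solutionEnergy_sq]
    refine Finset.sum_congr rfl fun K _ => ?_
    rw [hN, Finset.mul_sum]
    exact Finset.sum_congr rfl fun i _ => by rw [qweight, mul_assoc]
  have hb0 : 0 < b := by linarith
  have hκ := m.kappa_pos
  have hρ := m.rho_pos
  have hM' := fun K i => hM (m.side K i) _ (m.mem K i)
  have hkb : ∀ K i, 1 / m.kappa K i ≤ b := fun K i =>
    (one_div_le (hκ K i) hb0).2 (hM' K i).1
  have hrb : ∀ K i, 1 / m.rho K i ≤ b := fun K i =>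
    (one_div_le (hρ K i) hb0).2 (hM' K i).2.2.1
  have hbk : ∀ K i, 1 ≤ b * (1 / m.kappa K i) := fun K i => by
    rw [mul_one_div, one_le_div (hκ K i)]; exact (hM' K i).2.1
  have hbr : ∀ K i, 1 ≤ b * (1 / m.rho K i) := fun K i => by
    rw [mul_one_div, one_le_div (hρ K i)]; exact (hM' K i).2.2.2
  have hgap : ∀ K, ∃ v ∈ T.space K,
      (∀ j, evalAt v ((el (T.ref K)).mapNode (T.map K) j) =
        multiplier d s ((el (T.ref K)).mapNode (T.map K) j) *
          evalAt (u K) ((el (T.ref K)).mapNode (T.map K) j)) ∧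
      ∀ i, ‖s * T.val q u K i‖ ≤ b * c * N K ∧
        (∀ η, ‖1 / T.sval q d s η K i * T.dval q η u K i‖ ≤ b * c * N K) ∧
        ‖s * (evalAt v (T.qpoint q K i) - multiplier d s (T.qpoint q K i) * T.val q u K i)‖ ≤
          9 * b * c ^ 6 * (σ + 1) * (h * (t₁ + t₂)) * N K ∧
        ∀ η, ‖s * (evalAt (pderiv η v) (T.qpoint q K i) -
            (multiplier d s (T.qpoint q K i) * T.dval q η u K i +
              multiplierGrad d s η (T.qpoint q K i) * T.val q u K i))‖ ≤
          3 * (9 * b * c ^ 6 * (σ + 1)) * B * (‖s‖ * h * t₁ + t₂) * N K := fun K => by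
    obtain ⟨y, hy⟩ := hreg K
    have hdK : Metric.diam (T.cell K) ≤ h := (T.diam_le_size K).trans hh
    -- The estimate is applied with the diameter of `K`, since the cancellation against `‖A⁻¹ e_η‖`
    -- fails for a global `h` on meshes that are not quasi-uniform. Only the final bounds are
    -- enlarged to `h`.
    obtain ⟨v, hv, hvn, hve⟩ := LagrangeElement.exists_testFunction hp (hc (T.ref K)) hσ.le
      (A := T.map K) (fun x hx y hy => T.dist_le_diam hx hy)
      (LagrangeElement.diam_mul_norm_symm_le (hc (T.ref K)) hσ hy) Metric.diam_nonneg
      (hu.1 K) ht₁ ht₂ (hg K) (hG K) hb hB (s := s) (hbk K) (hbr K)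
      (S := fun i η => T.sval q d s η K i) (fun i η => hS _ (hq K i) η)
      (fun i η => stretch_ne_zero hs (hqd K i η)) (hN0 K) (hN K)
    have hN0' := hN0 K
    have hdn : 0 ≤ Metric.diam (T.cell K) := Metric.diam_nonneg
    refine ⟨v, hv, hvn, fun i => ?_⟩
    obtain ⟨h1, h2, h3, h4⟩ := hve i
    refine ⟨h1, h2, h3.trans ?_, fun η => (h4 η).trans ?_⟩
    · have : Metric.diam (T.cell K) * (t₁ + t₂) ≤ h * (t₁ + t₂) := by gcongr
      exact mul_le_mul_of_nonneg_right (mul_le_mul_of_nonneg_left this (by positivity)) hN0'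
    · have : ‖s‖ * Metric.diam (T.cell K) * t₁ + t₂ ≤ ‖s‖ * h * t₁ + t₂ := by gcongr
      exact (mul_le_mul_of_nonneg_right (mul_le_mul_of_nonneg_left this
        (by positivity : 0 ≤ 27 * b * c ^ 6 * (σ + 1) * B)) hN0').trans (le_of_eq (by ring))
  choose v hv hvn hve using hgap
  have htest : (fun K => s • v K) ∈ T.Vh :=
    mem_Vh_of_node_eq hu (fun x => s * multiplier d s x)
      (fun K => LagrangeElement.smul_mem_mapSpace s (hv K))
      fun K j => by rw [evalAt_smul, hvn]; ring
  set θ := 9 * b * c ^ 6 * (σ + 1) * (h * (t₁ + t₂)) with hθ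
  set τ := 90 * b ^ 3 * c ^ 7 * (σ + 1) * B ^ 3 * (‖s‖ * h * (t₁ + t₂) + t₂) with hτ
  set I : T.GridFun q ℂ := fun K i =>
    conj (s ^ 2 * (∏ η, T.sval q d s η K i) / (m.kappa K i : ℂ) * T.val q u K i) *
        (s * evalAt (v K) (T.qpoint q K i)) +
      ∑ η, conj (1 / (m.rho K i : ℂ) * (∏ ζ ∈ Finset.univ.erase η, T.sval q d s ζ K i) *
          (1 / T.sval q d s η K i * T.dval q η u K i)) *
        (s * evalAt (pderiv η (v K)) (T.qpoint q K i)) with hI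
  -- The integrand is the one with the exact test function, bounded by coercivity, plus the one with
  -- the interpolation error, bounded in norm.
  have hcoer : ∀ K i, (s.re - β / 2) * En K i - τ * N K ^ 2 ≤ (I K i).re := fun K i => by
    obtain ⟨h1, h2, h3, h4⟩ := hve K i
    have c1 := re_weakForm_ge hs (hκ K i) (hρ K i) hβ0 (hqd K i)
      (hβ (m.side K i) _ (m.mem K i)) (S := fun η => T.sval q d s η K i) (fun η => rfl)
      (T.val q u K i) (fun η => T.dval q η u K i)
      (g := multiplier d s (T.qpoint q K i))
      (G := fun η => multiplierGrad d s η (T.qpoint q K i)) rfl (fun η => rfl)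
    have c2 := norm_weakForm_error_le (hκ K i) (hρ K i) (hkb K i) (hrb K i) hB
      hc0 (hN0 K) (by positivity) hh0 ht₂
      (S := fun η => T.sval q d s η K i) (fun η => hS _ (hq K i) η) h1 h2 h3 h4
    have c3 := (abs_le.1 ((Complex.abs_re_le_norm _).trans c2)).1
    have c4 := add_le_add c1 c3
    rw [← Complex.add_re, add_add_add_comm, ← mul_add, ← Finset.sum_add_distrib] at c4
    simp only [← mul_add, add_sub_cancel] at c4
    refine le_trans (le_of_eq ?_) c4
    rw [hτ, hEn, energyDensity]
    ring
  have hsum : (∑ K, ∑ i, (T.qweight q K i : ℂ) * I K i) =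
      ∑ K, ∑ i, (T.qweight q K i : ℂ) *
        (conj (1 / (m.kappa K i : ℂ) * F K i) * (s * evalAt (v K) (T.qpoint q K i))) := by
    have h1 := hweak _ htest
    have e0 : T.val q (fun K => s • v K) = fun K i => s * evalAt (v K) (T.qpoint q K i) := by
      funext K i
      rw [val, evalAt_smul]
    have e1 : ∀ η, T.dval q η (fun K => s • v K) =
        fun K i => s * evalAt (pderiv η (v K)) (T.qpoint q K i) := fun η => by
      funext K i
      rw [dval, Derivation.map_smul, evalAt_smul]
    simp only [e0, e1] at h1
    rw [eq_comm, neg_add_eq_iff_eq_add, eq_comm, add_comm] at h1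
    unfold hInner at h1
    rw [← h1, Finset.sum_comm, ← Finset.sum_add_distrib]
    refine Finset.sum_congr rfl fun K _ => ?_
    rw [Finset.sum_comm, ← Finset.sum_add_distrib]
    refine Finset.sum_congr rfl fun i _ => ?_
    rw [hI, mul_add, Finset.mul_sum]
  have hqw : ∀ K i, 0 ≤ T.qweight q K i := qweight_nonneg
  have hmult : ∀ K i, ‖multiplier d s (T.qpoint q K i)‖ ≤ 1 := fun K i =>
    norm_multiplier_le hs (hqd K i)
  have hθ0 : 0 ≤ θ := by positivity
  have hτ0 : 0 ≤ τ := by positivity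
  have hsv : ∀ K i, ‖s * evalAt (v K) (T.qpoint q K i)‖ ≤ ‖s * T.val q u K i‖ + θ * N K :=
    fun K i => by
    obtain ⟨-, -, h3, -⟩ := hve K i
    have e : s * evalAt (v K) (T.qpoint q K i) =
        multiplier d s (T.qpoint q K i) * (s * T.val q u K i) +
        s * (evalAt (v K) (T.qpoint q K i) - multiplier d s (T.qpoint q K i) * T.val q u K i) := by
      ring
    rw [e]
    refine (norm_add_le _ _).trans (add_le_add ?_ h3)
    rw [norm_mul]
    exact mul_le_of_le_one_left (norm_nonneg _) (hmult K i)
  have hlower : (s.re - β / 2 - c ^ 2 * τ) * solutionEnergy m d s u ^ 2 ≤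
      ∑ K, ∑ i, T.qweight q K i * (I K i).re := by
    calc _ ≤ ∑ K, ∑ i, T.qweight q K i * ((s.re - β / 2) * En K i - τ * N K ^ 2) := by
          rw [hE, Finset.mul_sum]
          refine Finset.sum_le_sum fun K _ => ?_
          have e : ∑ i, T.qweight q K i * ((s.re - β / 2) * En K i - τ * N K ^ 2) =
              detK K * ((s.re - β / 2) * N K ^ 2 -
                (∑ i, (q (T.ref K)).weight i) * (τ * N K ^ 2)) := by
            have h1 : ∀ i, T.qweight q K i * ((s.re - β / 2) * En K i - τ * N K ^ 2) =
                (s.re - β / 2) * detK K * ((q (T.ref K)).weight i * En K i) -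
                  detK K * (τ * N K ^ 2) * (q (T.ref K)).weight i := fun i => by
              rw [qweight]; ring
            rw [Finset.sum_congr rfl fun i _ => h1 i, Finset.sum_sub_distrib, ← Finset.mul_sum,
              ← Finset.mul_sum, ← hN K]
            ring
          -- The error `τ * N K ^ 2` is charged at every quadrature point, so its total carries the
          -- sum of the weights.
          have hw : ∑ i, (q (T.ref K)).weight i ≤ c ^ 2 := by
            calc _ ≤ ∑ _i : Fin (q (T.ref K)).m, c :=
                  Finset.sum_le_sum fun i _ => (hc (T.ref K)).weight_le i
              _ = (q (T.ref K)).m * c := by simp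
              _ ≤ c * c := mul_le_mul_of_nonneg_right (hc (T.ref K)).m_le hc0
              _ = c ^ 2 := by ring
          have h1 := mul_le_mul_of_nonneg_right hw (mul_nonneg hτ0 (sq_nonneg (N K)))
          rw [e]
          calc _ = detK K * ((s.re - β / 2) * N K ^ 2 - c ^ 2 * (τ * N K ^ 2)) := by ring
            _ ≤ _ := mul_le_mul_of_nonneg_left (by linarith) (hdet0 K)
      _ ≤ _ := Finset.sum_le_sum fun K _ => Finset.sum_le_sum fun i _ =>
          mul_le_mul_of_nonneg_left (hcoer K i) (hqw K i)
  have hre : ∑ K, ∑ i, T.qweight q K i * (I K i).re =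
      (∑ K, ∑ i, (T.qweight q K i : ℂ) * I K i).re := by
    simp only [Complex.re_sum, Complex.re_ofReal_mul]
  have hκw : ∀ K i, 0 ≤ T.qweight q K i * (1 / m.kappa K i) := fun K i =>
    mul_nonneg (hqw K i) (one_div_pos.2 (hκ K i)).le
  have hF : √(∑ K, ∑ i, T.qweight q K i * (1 / m.kappa K i) * ‖F K i‖ ^ 2) = dataEnergy m F := by
    simp only [dataEnergy, hNormSq, mul_assoc]
  have hE0 : 0 ≤ solutionEnergy m d s u := Real.sqrt_nonneg _
  have hD0 : 0 ≤ dataEnergy m F := Real.sqrt_nonneg _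
  have hupper : (∑ K, ∑ i, (T.qweight q K i : ℂ) * I K i).re ≤
      (1 + b * c * θ) * (solutionEnergy m d s u * dataEnergy m F) := by
    have hX : √(∑ K, ∑ i, T.qweight q K i * (1 / m.kappa K i) * ‖s * T.val q u K i‖ ^ 2) ≤
        solutionEnergy m d s u := by
      refine Real.sqrt_le_iff.2 ⟨hE0, ?_⟩
      rw [solutionEnergy_sq]
      refine Finset.sum_le_sum fun K _ => Finset.sum_le_sum fun i _ => ?_
      rw [mul_assoc]
      refine mul_le_mul_of_nonneg_left (le_add_of_nonneg_right ?_) (hqw K i)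
      exact Finset.sum_nonneg fun η _ => mul_nonneg (one_div_pos.2 (hρ K i)).le (sq_nonneg _)
    -- The interpolation error enters the source term too; this is why the final inequality has the
    -- factor 2 instead of 1.
    have hR : √(∑ K, ∑ i, T.qweight q K i * (1 / m.kappa K i) * (θ * N K) ^ 2) ≤
        b * c * θ * solutionEnergy m d s u := by
      refine Real.sqrt_le_iff.2 ⟨by positivity, ?_⟩
      rw [mul_pow, hE, Finset.mul_sum]
      refine Finset.sum_le_sum fun K _ => ?_
      calc _ ≤ ∑ _i : Fin (q (T.ref K)).m, detK K * c * b * (θ * N K) ^ 2 := by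
            refine Finset.sum_le_sum fun i _ => mul_le_mul_of_nonneg_right ?_ (sq_nonneg _)
            exact mul_le_mul (mul_le_mul_of_nonneg_left ((hc (T.ref K)).weight_le i) (hdet0 K))
              (hkb K i) (one_div_pos.2 (hκ K i)).le (mul_nonneg (hdet0 K) hc0)
        _ = (q (T.ref K)).m * (detK K * c * b * (θ * N K) ^ 2) := by simp
        _ ≤ c * (detK K * c * b * (θ * N K) ^ 2) :=
            mul_le_mul_of_nonneg_right (hc (T.ref K)).m_le (by have := hdet0 K; positivity)
        _ = b * (c ^ 2 * θ ^ 2 * (detK K * N K ^ 2)) := by ring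
        _ ≤ b ^ 2 * (c ^ 2 * θ ^ 2 * (detK K * N K ^ 2)) :=
            mul_le_mul_of_nonneg_right (by nlinarith) (by have := hdet0 K; positivity)
        _ = _ := by ring
    calc _ ≤ ∑ K, ∑ i, (T.qweight q K i * (1 / m.kappa K i) * (‖F K i‖ * ‖s * T.val q u K i‖) +
          T.qweight q K i * (1 / m.kappa K i) * (‖F K i‖ * (θ * N K))) := by
          rw [hsum, Complex.re_sum]
          refine Finset.sum_le_sum fun K _ => ?_
          rw [Complex.re_sum]
          refine Finset.sum_le_sum fun i _ => (Complex.re_le_norm _).trans ?_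
          have e : ‖(T.qweight q K i : ℂ) * (conj (1 / (m.kappa K i : ℂ) * F K i) *
              (s * evalAt (v K) (T.qpoint q K i)))‖ =
              T.qweight q K i * (1 / m.kappa K i) *
                (‖F K i‖ * ‖s * evalAt (v K) (T.qpoint q K i)‖) := by
            rw [norm_mul, norm_mul, Complex.norm_conj, norm_mul, norm_div, norm_one,
              Complex.norm_real, Complex.norm_real, Real.norm_of_nonneg (hqw K i),
              Real.norm_of_nonneg (hκ K i).le]
            ring
          rw [e, ← mul_add, ← mul_add]
          exact mul_le_mul_of_nonneg_left
            (mul_le_mul_of_nonneg_left (hsv K i) (norm_nonneg _)) (hκw K i)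
      _ ≤ dataEnergy m F * solutionEnergy m d s u +
          dataEnergy m F * (b * c * θ * solutionEnergy m d s u) := by
          simp only [Finset.sum_add_distrib]
          refine add_le_add ((sum_sum_mul_le_sqrt_mul_sqrt hκw).trans ?_)
            ((sum_sum_mul_le_sqrt_mul_sqrt hκw).trans ?_)
          · rw [hF]
            exact mul_le_mul_of_nonneg_left hX hD0
          · rw [hF]
            exact mul_le_mul_of_nonneg_left hR hD0
      _ = _ := by ring
  have hfin := (hlower.trans_eq hre).trans hupper
  have e1 : c ^ 2 * τ =
      90 * b ^ 3 * c ^ 9 * (σ + 1) * B ^ 3 * (‖s‖ * h * (t₁ + t₂) + t₂) := by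
    rw [hτ]; ring
  have e2 : b * c * θ = 9 * b ^ 2 * c ^ 7 * (σ + 1) * (h * (t₁ + t₂)) := by rw [hθ]; ring
  rwa [e1, e2] at hfin

end Mesh

/-! ### Bounds for the damping and the medium. -/

/-- A finite damping rate `β` bounds the derivatives of the damping functions. -/
theorem sqrt_mul_abs_deriv_le_dampingRate {Ω : Set E3} {M : Medium Ω} {d : Fin 3 → ℝ → ℝ}
    (hβ : dampingRate M d ≠ ⊤) {j : M.J} {x : E3} (hx : x ∈ closure (M.sub j)) {η : Fin 3}
    (hd : 0 ≤ d η (x η)) :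
    √(M.kappa j x / M.rho j x) * |deriv (d η) (x η)| ≤ (dampingRate M d).toReal * d η (x η) := by
  have h1 : ENNReal.ofReal (√(M.kappa j x / M.rho j x) * |deriv (d η) (x η)|) /
      ENNReal.ofReal (d η (x η)) ≤ dampingRate M d :=
    le_iSup_of_le η (le_iSup_of_le j (le_iSup_of_le x (le_iSup_of_le hx le_rfl)))
  -- Finiteness of `β` allows clearing the denominator even where `d` vanishes; there it forces `d'
  -- = 0`.
  rw [ENNReal.div_le_iff_le_mul (Or.inr hβ) (Or.inl ENNReal.ofReal_ne_top)] at h1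
  have h2 := ENNReal.toReal_mono (ENNReal.mul_ne_top hβ ENNReal.ofReal_ne_top) h1
  rwa [ENNReal.toReal_mul, ENNReal.toReal_ofReal hd, ENNReal.toReal_ofReal (by positivity)] at h2

theorem eventually_one_div_le_and_le {X : Type*} [TopologicalSpace X] {K : Set X}
    (hK : IsCompact K) {f : X → ℝ} (hf : ContinuousOn f K) (hpos : ∀ x ∈ K, 0 < f x) :
    ∀ᶠ b : ℝ in Filter.atTop, ∀ x ∈ K, 1 / b ≤ f x ∧ f x ≤ b := by
  obtain ⟨b₁, h₁⟩ := hK.exists_bound_of_continuousOn hf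
  obtain ⟨b₂, h₂⟩ := hK.exists_bound_of_continuousOn (hf.inv₀ fun x hx => (hpos x hx).ne')
  filter_upwards [Filter.eventually_gt_atTop 0, Filter.eventually_ge_atTop b₁,
    Filter.eventually_ge_atTop b₂] with b hb hb₁ hb₂ x hx
  refine ⟨(one_div_le hb (hpos x hx)).2 ?_, ((le_abs_self _).trans (h₁ x hx)).trans hb₁⟩
  rw [one_div]
  exact ((le_abs_self _).trans (h₂ x hx)).trans hb₂

/-- A piecewise continuous medium in a bounded domain is bounded from above and from below. -/
theorem Medium.eventually_bounds {Ω : Set E3} (M : Medium Ω) (hΩ : Bornology.IsBounded Ω) :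
    ∀ᶠ b : ℝ in Filter.atTop, ∀ j, ∀ x ∈ closure (M.sub j),
      1 / b ≤ M.kappa j x ∧ M.kappa j x ≤ b ∧ 1 / b ≤ M.rho j x ∧ M.rho j x ≤ b := by
  have := M.finite
  refine Filter.eventually_all.2 fun j => ?_
  have hK : IsCompact (closure (M.sub j)) := by
    refine Metric.isCompact_of_isClosed_isBounded isClosed_closure (hΩ.closure.subset ?_)
    rw [← M.cover]
    exact Set.subset_iUnion (fun j => closure (M.sub j)) j
  filter_upwards [eventually_one_div_le_and_le hK (M.kappa_cont j) (M.kappa_pos j),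
    eventually_one_div_le_and_le hK (M.rho_cont j) (M.rho_pos j)] with b h₁ h₂ x hx
  exact ⟨(h₁ x hx).1, (h₁ x hx).2, (h₂ x hx).1, (h₂ x hx).2⟩

/-- First-order Taylor estimate with the oscillation of the derivative. -/
theorem abs_sub_sub_deriv_mul_le {f : ℝ → ℝ} (hf : Differentiable ℝ f) {x y k l : ℝ}
    (h : ∀ z ∈ Set.uIcc y x, |deriv f z - l| ≤ k) :
    |f x - f y - l * (x - y)| ≤ k * |x - y| := by
  have h1 : ∀ z ∈ Set.uIcc y x, HasDerivWithinAt (fun t => f t - l * t) (deriv f z - l)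
      (Set.uIcc y x) z := fun z _ => by
    simpa using ((hf z).hasDerivAt.fun_sub ((hasDerivAt_id' z).const_mul l)).hasDerivWithinAt
  have h2 := (convex_uIcc y x).norm_image_sub_le_of_norm_hasDerivWithin_le h1 h
    Set.left_mem_uIcc Set.right_mem_uIcc
  rw [Real.norm_eq_abs, Real.norm_eq_abs] at h2
  convert h2 using 2
  ring

/-- Coordinates between those of two points of a convex set are attained in the set. -/
theorem exists_mem_apply_eq {s : Set E3} (hs : Convex ℝ s) {x y : E3} (hx : x ∈ s) (hy : y ∈ s)
    {η : Fin 3} {z : ℝ} (hz : z ∈ Set.uIcc (y η) (x η)) : ∃ w ∈ s, w η = z := by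
  rw [← segment_eq_uIcc, segment_eq_image'] at hz
  obtain ⟨θ, hθ, rfl⟩ := hz
  exact ⟨y + θ • (x - y), hs.add_smul_sub_mem hy hx hθ, by simp⟩

/-! ### Error terms expressed by the damping functions. -/

namespace Mesh

variable {Ω : Set E3} {p : ℕ} {R : Type} {el : R → LagrangeElement p} {T : Mesh Ω el}
  {q : ∀ r, Quadrature (el r)} {M : Medium Ω}

/-- The energy inequality with interpolation errors in terms of bounds for the damping functions,
for their derivatives, and for the oscillation of the derivatives on an element. -/
theorem energy_inequality_of_damping (hp : 1 ≤ p) {c σ h b D Λ ω n : ℝ} (hσ : 0 < σ)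
    (hc1 : 1 ≤ c) (hc : ∀ r, RefBound (el r) (q r) c)
    (hreg : T.ShapeRegular σ) (m : T.Sampling q M) {d : Fin 3 → ℝ → ℝ}
    (hd : ∀ η, ContDiff ℝ 1 (d η)) (hd0 : ∀ x ∈ closure Ω, ∀ η, 0 ≤ d η (x η))
    (hβ : dampingRate M d ≠ ⊤) (hb : 1 ≤ b)
    (hM : ∀ j, ∀ x ∈ closure (M.sub j), 1 / b ≤ M.kappa j x ∧ M.kappa j x ≤ b ∧
      1 / b ≤ M.rho j x ∧ M.rho j x ≤ b)
    (hD0 : 0 ≤ D) (hD : ∀ x ∈ closure Ω, ∀ η, d η (x η) ≤ D)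
    (hΛ0 : 0 ≤ Λ) (hΛ : ∀ x ∈ closure Ω, ∀ η, |deriv (d η) (x η)| ≤ Λ)
    (hω0 : 0 ≤ ω) (hω : ∀ K, ∀ x ∈ T.cell K, ∀ y ∈ T.cell K, ∀ η,
      |deriv (d η) (x η) - deriv (d η) (y η)| ≤ ω)
    (hh : T.size ≤ h) {s : ℂ} (hs : 0 < s.re) (hn : 0 < n) (hns : n ≤ ‖s‖)
    (F : T.GridFun q ℂ) {u : T.ι → MvPolynomial (Fin 3) ℂ} (hu : u ∈ T.Vh)
    (hweak : ReducedWeakForm m d s F u) :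
    (s.re - (dampingRate M d).toReal / 2 - 90 * b ^ 3 * c ^ 9 * (σ + 1) * (1 + D / n) ^ 3 *
        (h * (3 * Λ + 3 * ω + 6 * Λ ^ 2 * h / n) + (3 * ω / n + 6 * Λ ^ 2 * h / n ^ 2))) *
        solutionEnergy m d s u ^ 2 ≤
      (1 + 9 * b ^ 2 * c ^ 7 * (σ + 1) * (h * (3 * Λ + 3 * ω + 6 * Λ ^ 2 * h / n) / ‖s‖)) *
        (solutionEnergy m d s u * dataEnergy m F) := by
  have hh0 : 0 ≤ h := T.size_nonneg.trans hh
  have hs0 : 0 < ‖s‖ := hn.trans_le hns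
  have hest : ∀ K, ∀ x ∈ T.cell K, ∀ y ∈ T.cell K, _ ∧ _ := fun K x hx y hy =>
    have hcoord : ∀ η, |x η - y η| ≤ dist x y := fun η => by
      rw [dist_eq_norm]
      exact PiLp.norm_apply_le (x - y) η
    have hconv : Convex ℝ (T.cell K) := LagrangeElement.convex_mapCell _
    multiplier_estimates (d := d) (Λ := Λ) (ω := ω) hs (hd0 x (T.cell_subset K hx))
      (hd0 y (T.cell_subset K hy)) ((T.dist_le_diam hx hy).trans ((T.diam_le_size K).trans hh))
      (fun η => by
        -- With slope `l = 0` this is the Lipschitz bound. The bounds on `d η` hold only at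
        -- coordinates of points of the closure of `Ω`; convexity of the cell provides such a point
        -- for each intermediate `z`.
        have := abs_sub_sub_deriv_mul_le (l := 0) (k := Λ)
          ((hd η).differentiable one_ne_zero) (x := x η) (y := y η) fun z hz => by
            obtain ⟨w, hw, rfl⟩ := exists_mem_apply_eq hconv hx hy hz
            simpa using hΛ w (T.cell_subset K hw) η
        rw [zero_mul, sub_zero] at this
        exact this.trans (mul_le_mul_of_nonneg_left (hcoord η) hΛ0))
      (hΛ y (T.cell_subset K hy))
      (fun η => (abs_sub_sub_deriv_mul_le ((hd η).differentiable one_ne_zero) fun z hz => by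
          obtain ⟨w, hw, rfl⟩ := exists_mem_apply_eq hconv hx hy hz
          exact hω K w hw y hy η).trans (mul_le_mul_of_nonneg_left (hcoord η) hω0))
  have hS : ∀ x ∈ closure Ω, ∀ η, ‖stretch d s η x‖ ≤ 1 + D / n := fun x hx η => by
    refine (norm_add_le _ _).trans (add_le_add (by simp) ?_)
    rw [norm_div, Complex.norm_real, Real.norm_of_nonneg (hd0 x hx η)]
    exact div_le_div₀ hD0 (hD x hx η) hn hns
  have key := energy_inequality hp hσ hc1 hc hreg m hd0 ENNReal.toReal_nonneg
    (fun j x hx η => sqrt_mul_abs_deriv_le_dampingRate hβ hx (hd0 x (by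
      rw [← M.cover]; exact Set.mem_iUnion.2 ⟨j, hx⟩) η)) hb
    (le_add_of_nonneg_right (by positivity)) hM hs hS hh
    (t₁ := 3 * Λ / ‖s‖) (t₂ := 3 * ω / ‖s‖ + 6 * Λ ^ 2 * h / ‖s‖ ^ 2)
    (by positivity) (by positivity) (fun K x hx y hy => (hest K x hx y hy).1)
    (fun K x hx y hy => (hest K x hx y hy).2) F hu hweak
  have hE0 : 0 ≤ solutionEnergy m d s u := Real.sqrt_nonneg _
  have hF0 : 0 ≤ dataEnergy m F := Real.sqrt_nonneg _
  have e : h * (3 * Λ / ‖s‖ + (3 * ω / ‖s‖ + 6 * Λ ^ 2 * h / ‖s‖ ^ 2)) =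
      h * (3 * Λ + 3 * ω + 6 * Λ ^ 2 * h / ‖s‖) / ‖s‖ := by field_simp; ring
  -- The growing factor `‖s‖` cancels against the decay of the increments of the multiplier, so the
  -- bound is uniform for `n ≤ ‖s‖`.
  have e' : ‖s‖ * h * (3 * Λ / ‖s‖ + (3 * ω / ‖s‖ + 6 * Λ ^ 2 * h / ‖s‖ ^ 2)) =
      h * (3 * Λ + 3 * ω + 6 * Λ ^ 2 * h / ‖s‖) := by field_simp; ring
  rw [e, e'] at key
  refine le_trans (mul_le_mul_of_nonneg_right (sub_le_sub_left ?_ _) (sq_nonneg _))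
    (key.trans (mul_le_mul_of_nonneg_right ?_ (mul_nonneg hE0 hF0)))
  · gcongr
  · gcongr

theorem size_le_diam (hΩ : Bornology.IsBounded Ω) : T.size ≤ Metric.diam (closure Ω) :=
  Real.iSup_le (fun K => Metric.diam_mono (T.cell_subset K) hΩ.closure) Metric.diam_nonneg

end Mesh

end PML

/-! ### The choice of `βh` and of the constant. -/

theorem theorem5 (Ω : Set PML.E3) (hΩ : IsOpen Ω) (hΩb : Bornology.IsBounded Ω)
    (M : PML.Medium Ω)
    (d : Fin 3 → ℝ → ℝ) (hd : ∀ η, ContDiff ℝ 1 (d η))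
    (hd0 : ∀ x ∈ closure Ω, ∀ η, 0 ≤ d η (x η))
    (hβ : PML.dampingRate M d ≠ ⊤)
    (p : ℕ) (hp : 1 ≤ p)
    (R : Type) [Finite R] (el : R → PML.LagrangeElement p)
    (q : ∀ r, PML.Quadrature (el r)) (hq : ∀ r, PML.InterpolationCondition (q r))
    (σ : ℝ) (hσ : 0 < σ) :
    ∃ C : ℝ, ∀ T : PML.Mesh Ω el, T.ShapeRegular σ → ∀ m : T.Sampling q M,
      ∃ βh : ℝ, |βh - (PML.dampingRate M d).toReal| ≤ C * T.size ^ (p - 1) ∧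
        ∀ s : ℂ, βh < s.re → ∀ F : T.GridFun q ℂ, ∀ u ∈ T.Vh,
          PML.Mesh.ReducedWeakForm m d s F u →
            (s.re - βh) * PML.Mesh.solutionEnergy m d s u ^ 2 ≤
              2 * PML.Mesh.solutionEnergy m d s u * PML.Mesh.dataEnergy m F := by
  obtain ⟨c, hc1, hc⟩ := ((Filter.eventually_ge_atTop (1 : ℝ)).and
    (Filter.eventually_all.2 fun r => PML.eventually_refBound (el r) (q r) (hq r))).exists
  obtain ⟨b, hb1, hM⟩ := ((Filter.eventually_ge_atTop (1 : ℝ)).and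
    (M.eventually_bounds hΩb)).exists
  have hcpt : IsCompact (closure Ω) := hΩb.isCompact_closure
  have hdc : ∀ η, Continuous fun x : PML.E3 => d η (x η) := fun η =>
    (hd η).continuous.comp (by fun_prop)
  have hddc : ∀ η, Continuous fun x : PML.E3 => deriv (d η) (x η) := fun η =>
    ((hd η).continuous_deriv le_rfl).comp (by fun_prop)
  obtain ⟨D, hD0, hD⟩ : ∃ D : ℝ, 0 ≤ D ∧ ∀ x ∈ closure Ω, ∀ η, d η (x η) ≤ D := by
    choose D hD using fun η => hcpt.exists_bound_of_continuousOn (hdc η).continuousOn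
    obtain ⟨D', hD'⟩ := Finite.exists_le D
    exact ⟨max 0 D', le_max_left _ _, fun x hx η =>
      ((le_abs_self _).trans (hD η x hx)).trans ((hD' η).trans (le_max_right _ _))⟩
  set β := (PML.dampingRate M d).toReal with hβdef
  have hE0 : ∀ {T : PML.Mesh Ω el} (m : T.Sampling q M) (s : ℂ)
      (F : T.GridFun q ℂ) (u : T.ι → MvPolynomial (Fin 3) ℂ),
      0 ≤ PML.Mesh.solutionEnergy m d s u * PML.Mesh.dataEnergy m F := fun m s F u =>
    mul_nonneg (Real.sqrt_nonneg _) (Real.sqrt_nonneg _)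
  have hβ0 : 0 ≤ β := ENNReal.toReal_nonneg
  -- For `β = 0` there is no surplus `β / 2` and no lower bound for `|s|`, but then the multiplier
  -- is constant on the closure of `Ω` and there is no error to absorb.
  rcases hβ0.eq_or_lt with h0 | hpos
  · have hder : ∀ x ∈ closure Ω, ∀ η, deriv (d η) (x η) = 0 := fun x hx η => by
      have hx' := hx
      rw [← M.cover] at hx'
      obtain ⟨j, hj⟩ := Set.mem_iUnion.1 hx'
      have h1 := PML.sqrt_mul_abs_deriv_le_dampingRate hβ hj (hd0 x hx η)
      rw [← hβdef, ← h0, zero_mul] at h1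
      have h2 : 0 < √(M.kappa j x / M.rho j x) :=
        Real.sqrt_pos.2 (div_pos (M.kappa_pos j x hj) (M.rho_pos j x hj))
      exact abs_nonpos_iff.1 (nonpos_of_mul_nonpos_right h1 h2)
    refine ⟨0, fun T hT m => ⟨0, by simp [← h0], fun s hs F u hu hw => ?_⟩⟩
    have hs0 : 0 < ‖s‖ := norm_pos_iff.2 (PML.ne_zero_of_re_pos hs)
    have key := PML.Mesh.energy_inequality_of_damping (Λ := 0) (ω := 0) hp hσ hc1 hc hT m hd hd0
      hβ hb1 hM hD0 hD le_rfl (fun x hx η => by simp [hder x hx η]) le_rfl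
      (fun K x hx y hy η => by
        simp [hder x (T.cell_subset K hx) η, hder y (T.cell_subset K hy) η]) le_rfl hs hs0
      le_rfl F hu hw
    rw [← hβdef, ← h0] at key
    simp only [mul_zero, zero_div, add_zero, sub_zero, zero_mul, one_mul,
      zero_pow two_ne_zero] at key
    have := hE0 m s F u
    linarith
  · obtain ⟨Λ, hΛ0, hΛ⟩ : ∃ Λ : ℝ, 0 ≤ Λ ∧ ∀ x ∈ closure Ω, ∀ η, |deriv (d η) (x η)| ≤ Λ := by
      choose D hD using fun η => hcpt.exists_bound_of_continuousOn (hddc η).continuousOn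
      obtain ⟨D', hD'⟩ := Finite.exists_le D
      exact ⟨max 0 D', le_max_left _ _, fun x hx η =>
        (hD η x hx).trans ((hD' η).trans (le_max_right _ _))⟩
    set C₁ := 90 * b ^ 3 * c ^ 9 * (σ + 1) with hC₁
    set C₂ := 9 * b ^ 2 * c ^ 7 * (σ + 1) with hC₂
    have hC₁0 : 0 ≤ C₁ := by positivity
    have hC₂0 : 0 ≤ C₂ := by positivity
    -- The number `t` bounds both the mesh size and the oscillation of `d'` on an element. The lower
    -- bound for `|s|` is `β`, as `|s| ≥ Re s > β`.
    obtain ⟨t, ht0, ht₁, ht₂⟩ : ∃ t : ℝ, 0 < t ∧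
        C₁ * (1 + D / β) ^ 3 * (t * (3 * Λ + 3 * t + 6 * Λ ^ 2 * t / β) +
          (3 * t / β + 6 * Λ ^ 2 * t / β ^ 2)) ≤ β / 2 ∧
        C₂ * (t * (3 * Λ + 3 * t + 6 * Λ ^ 2 * t / β) / β) ≤ 1 := by
      have l₁ : Filter.Tendsto (fun t : ℝ => C₁ * (1 + D / β) ^ 3 *
          (t * (3 * Λ + 3 * t + 6 * Λ ^ 2 * t / β) + (3 * t / β + 6 * Λ ^ 2 * t / β ^ 2)))
          (nhdsWithin 0 (Set.Ioi 0)) (nhds 0) := by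
        refine tendsto_nhdsWithin_of_tendsto_nhds ?_
        refine Continuous.tendsto' (by fun_prop) _ _ (by simp)
      have l₂ : Filter.Tendsto (fun t : ℝ => C₂ * (t * (3 * Λ + 3 * t + 6 * Λ ^ 2 * t / β) / β))
          (nhdsWithin 0 (Set.Ioi 0)) (nhds 0) := by
        refine tendsto_nhdsWithin_of_tendsto_nhds ?_
        refine Continuous.tendsto' (by fun_prop) _ _ (by simp)
      obtain ⟨t, h1, h2, h3⟩ := ((eventually_mem_nhdsWithin (s := Set.Ioi (0 : ℝ))).and
        ((l₁.eventually_le_const (by positivity : 0 < β / 2)).and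
          (l₂.eventually_le_const one_pos))).exists
      exact ⟨t, h1, h2, h3⟩
    obtain ⟨δ, hδ0, hδ⟩ : ∃ δ : ℝ, 0 < δ ∧ ∀ x ∈ closure Ω, ∀ y ∈ closure Ω, dist x y < δ →
        ∀ η, |deriv (d η) (x η) - deriv (d η) (y η)| ≤ t := by
      have hu := fun η => Metric.uniformContinuousOn_iff.1
        (hcpt.uniformContinuousOn_of_continuous (hddc η).continuousOn) t ht0
      choose δ hδ0 hδ using hu
      refine ⟨min (δ 0) (min (δ 1) (δ 2)), by simp [hδ0], fun x hx y hy hxy η => ?_⟩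
      refine (hδ η x hx y hy (hxy.trans_le ?_)).le
      fin_cases η <;> simp
    set h₀ := min t (δ / 2) with hh₀
    have hh₀0 : 0 < h₀ := lt_min ht0 (by linarith)
    set H := Metric.diam (closure Ω) with hH
    have hH0 : 0 ≤ H := Metric.diam_nonneg
    set Φ := H * (3 * Λ + 3 * (2 * Λ) + 6 * Λ ^ 2 * H / 1) with hΦ
    have hΦ0 : 0 ≤ Φ := by positivity
    -- The first summand dominates the error on any mesh, with `h` replaced by the diameter of `Ω`
    -- and the oscillation by `2 * Λ`. The second forces `|s| ≥ 1 + C₂ * Φ`, so that `1` is a lower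
    -- bound for `|s|` and the source factor is at most 2.
    set Γ := C₁ * (1 + D / 1) ^ 3 * (Φ + (3 * (2 * Λ) / 1 + 6 * Λ ^ 2 * H / 1 ^ 2)) +
      (1 + C₂ * Φ) with hΓ
    have hΓ₁ : 0 ≤ C₁ * (1 + D / 1) ^ 3 * (Φ + (3 * (2 * Λ) / 1 + 6 * Λ ^ 2 * H / 1 ^ 2)) := by
      positivity
    have hΓ₂ : 0 ≤ C₂ * Φ := by positivity
    have hΓ0 : 0 ≤ Γ := by linarith
    -- This makes `C * T.size ^ (p - 1)` at least `Γ` as soon as `T.size > h₀`; for finer meshes `βh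
    -- = β` and any nonnegative constant would do.
    refine ⟨Γ / h₀ ^ (p - 1), fun T hT m => ?_⟩
    rcases le_or_gt T.size h₀ with hsmall | hlarge
    · refine ⟨β, ?_, fun s hs F u hu hw => ?_⟩
      · rw [sub_self, abs_zero]
        have := T.size_nonneg
        positivity
      have hβs : β ≤ ‖s‖ := hs.le.trans (Complex.re_le_norm s)
      have key := PML.Mesh.energy_inequality_of_damping hp hσ hc1 hc hT m hd hd0 hβ hb1 hM hD0 hD
        hΛ0 hΛ ht0.le (fun K x hx y hy η => hδ x (T.cell_subset K hx) y (T.cell_subset K hy)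
          (((T.dist_le_diam hx hy).trans ((T.diam_le_size K).trans
            (hsmall.trans (min_le_right _ _)))).trans_lt (by linarith)) η)
        (hsmall.trans (min_le_left _ _)) (hpos.trans hs) hpos hβs F hu hw
      have h2 : C₂ * (t * (3 * Λ + 3 * t + 6 * Λ ^ 2 * t / β) / ‖s‖) ≤ 1 := by
        refine le_trans ?_ ht₂
        gcongr
      calc _ ≤ _ := mul_le_mul_of_nonneg_right (by linarith) (sq_nonneg _)
        _ ≤ _ := key
        _ ≤ 2 * (PML.Mesh.solutionEnergy m d s u * PML.Mesh.dataEnergy m F) :=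
          mul_le_mul_of_nonneg_right (by linarith) (hE0 m s F u)
        _ = _ := by ring
    · refine ⟨β + Γ, ?_, fun s hs F u hu hw => ?_⟩
      · rw [add_sub_cancel_left, abs_of_nonneg hΓ0, div_mul_eq_mul_div, le_div_iff₀ (by positivity)]
        exact mul_le_mul_of_nonneg_left (pow_le_pow_left₀ hh₀0.le hlarge.le _) hΓ0
      have hs1 : 1 + C₂ * Φ ≤ ‖s‖ := by linarith [Complex.re_le_norm s]
      have key := PML.Mesh.energy_inequality_of_damping (ω := 2 * Λ) (n := 1) hp hσ hc1 hc hT m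
        hd hd0 hβ hb1 hM hD0 hD hΛ0 hΛ (by positivity)
        (fun K x hx y hy η => (abs_sub _ _).trans (by
          linarith [hΛ x (T.cell_subset K hx) η, hΛ y (T.cell_subset K hy) η]))
        (PML.Mesh.size_le_diam hΩb) (by linarith : 0 < s.re) one_pos (by linarith) F hu hw
      rw [← hH, ← hΦ, ← hC₁, ← hC₂, ← hβdef] at key
      have h2 : C₂ * (Φ / ‖s‖) ≤ 1 := by
        rw [← mul_div_assoc]
        exact div_le_one_of_le₀ (by linarith) (norm_nonneg _)
      calc _ ≤ _ := mul_le_mul_of_nonneg_right (by linarith) (sq_nonneg _)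
        _ ≤ _ := key
        _ ≤ 2 * (PML.Mesh.solutionEnergy m d s u * PML.Mesh.dataEnergy m F) :=
          mul_le_mul_of_nonneg_right (by linarith) (hE0 m s F u)
        _ = _ := by ring
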